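/- For a (complex) Banach algebra $\mathfrak A$, let $\mathfrak A\otimes^\gamma\mathfrak A$ be the projective tensor product, with multiplication map $m(a\otimes b)=ab$ and actions $a\cdot(b\otimes c)=(ab)\otimes c$, $(b\otimes c)\cdot a=b\otimes(ca)$. A bounded approximate diagonal for $\mathfrak A$ is a bounded net $(D_\alpha)$ in $\mathfrak A\otimes^\gamma\mathfrak A$ such that $a\,m(D_\alpha)\to a$, $m(D_\alpha)a\to a$ and $a\cdot D_\alpha-D_\alpha\cdot a\to 0$ for every $a\in\mathfrak A$. The algebra $\mathfrak A$ is amenable if it has a bounded approximate diagonal, and its amenability constant is $$\mathrm{AM}(\mathfrak A)=\inf\Bigl\{\sup_\alpha\|D_\alpha\|_\gamma : (D_\alpha)\text{ is a bounded approximate diagonal for }\mathfrak A\Bigr\}$$ (with $\inf\varnothing=\infty$). Let $S$ be a finite semilattice, i.e. a finite commutative semigroup in which $ss=s$ for all $s$, ordered by $s\le t\iff st=s$, and let $\ell^1(S)$ be its semigroup algebra with convolution product, $\delta_s*\delta_t=\delta_{st}$, and the $\ell^1$-norm. **Theorem 2.2.** Let $\mathfrak A$ be a Banach algebra graded over $S$: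 there are closed subspaces $\mathfrak A_s$ ($s\in S$) with $\mathfrak A=\ell^1\text{-}\bigoplus_{s\in S}\mathfrak A_s$ and $\mathfrak A_s\mathfrak A_t\subseteq\mathfrak A_{st}$ for all $s,t\in S$. Suppose that every $\mathfrak A_s$ is nonzero and is an amenable Banach algebra, and that at least one of the following holds: * (LA1) for each $s\in S$ there is a bounded approximate identity $(u_{s,\alpha})_\alpha$ in $\mathfrak A_s$ such that $\lim_\alpha u_{s,\alpha}a_t=a_t=\lim_\alpha a_tu_{s,\alpha}$ for every $t\le s$ and $a_t\in\mathfrak A_t$; * (LA2) for each $s\in S$ there is a contractive character (a nonzero multiplicative linear functional of norm at most $1$) $\chi_s:\mathfrak A_s\to\mathbb C$ such that $\chi_{st}(a_sb_t)=\chi_s(a_s)\chi_t(b_t)$ for all $s,t\in S$, $a_s\in\mathfrak A_s$, $b_t\in\mathfrak A_t$. Then $\mathfrak A$ is amenable and $\mathrm{AM}(\mathfrak A)\ge\mathrm{AM}(\ell^1(S))$. -/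

import Mathlib

open Filter Topology UniformSpace
open scoped TensorProduct ENNReal

universe u v

noncomputable section

/-! ### The projective tensor square of a Banach algebra -/

section ProjectiveTensor

variable (A : Type u) [NonUnitalNormedRing A] [NormedSpace ℂ A]

/-- The projective tensor product of `A` with itself: the completion of the algebraic tensor
product `A ⊗ A` for Mathlib's projective seminorm, which is the infimum of `∑ j, ‖a j‖ * ‖b j‖` over
all representations `∑ j, a j ⊗ b j`. -/
abbrev ProjTensorSq : Type u := Completion (⨂[ℂ] _ : Fin 2, A)

variable {A}

/-- The extension to completions of a bounded operator on the algebraic tensor product. -/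
def completionMap (T : (⨂[ℂ] _ : Fin 2, A) →L[ℂ] (⨂[ℂ] _ : Fin 2, A)) :
    ProjTensorSq A →L[ℂ] ProjTensorSq A :=
  (Completion.toComplL.comp T).extend
    (Completion.toComplL : (⨂[ℂ] _ : Fin 2, A) →L[ℂ] ProjTensorSq A)

variable [IsScalarTower ℂ A A] [SMulCommClass ℂ A A]

/-- The left module action, `a · (b ⊗ c) = (a * b) ⊗ c`. -/
def leftAct (a : A) : ProjTensorSq A →L[ℂ] ProjTensorSq A :=
  completionMap (PiTensorProduct.mapL
    ![ContinuousLinearMap.mul ℂ A a, ContinuousLinearMap.id ℂ A])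

/-- The right module action, `(b ⊗ c) · a = b ⊗ (c * a)`. -/
def rightAct (a : A) : ProjTensorSq A →L[ℂ] ProjTensorSq A :=
  completionMap (PiTensorProduct.mapL
    ![ContinuousLinearMap.id ℂ A, (ContinuousLinearMap.mul ℂ A).flip a])

variable (A) in
/-- The product `(a, b) ↦ a * b` as a continuous multilinear map. -/
def mulMultilinear : ContinuousMultilinearMap ℂ (fun _ : Fin 2 => A) A :=
  MultilinearMap.mkContinuous
    { toFun := fun x => x 0 * x 1
      map_update_add' := by
        intro _ m i x y
        fin_cases i <;> simp [Function.update, add_mul, mul_add]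
      map_update_smul' := by
        intro _ m i c x
        fin_cases i <;> simp [Function.update, smul_mul_assoc, mul_smul_comm] }
    1 (fun x => by simpa using norm_mul_le (x 0) (x 1))

variable (A) in
/-- The multiplication map `m`, `m (a ⊗ b) = a * b`, on the projective tensor product. -/
def mulMap [CompleteSpace A] : ProjTensorSq A →L[ℂ] A :=
  (PiTensorProduct.liftIsometry ℂ (fun _ : Fin 2 => A) A (mulMultilinear A)).extend
    (Completion.toComplL : (⨂[ℂ] _ : Fin 2, A) →L[ℂ] ProjTensorSq A)

end ProjectiveTensor

/-! ### Amenability and the amenability constant -/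

section Amenability

variable (A : Type u) [NonUnitalNormedRing A] [NormedSpace ℂ A]
  [IsScalarTower ℂ A A] [SMulCommClass ℂ A A] [CompleteSpace A]

/-- A bounded approximate diagonal: a bounded net in the projective tensor product, whose image
under `m` is an approximate identity (automatically bounded), and which is asymptotically central. -/
structure IsBoundedApproxDiagonal {ι : Type*} [Preorder ι] (D : ι → ProjTensorSq A) : Prop where
  bounded : ∃ C : ℝ, ∀ α, ‖D α‖ ≤ C
  mul_left : ∀ a : A, Tendsto (fun α => a * mulMap A (D α)) atTop (𝓝 a)
  mul_right : ∀ a : A, Tendsto (fun α => mulMap A (D α) * a) atTop (𝓝 a)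
  central : ∀ a : A, Tendsto (fun α => leftAct a (D α) - rightAct a (D α)) atTop (𝓝 0)

/-- A Banach algebra is amenable if it admits a bounded approximate diagonal, indexed by some
nonempty directed set. (Index sets in the universe of `A` suffice.) -/
def IsAmenable : Prop :=
  ∃ (ι : Type u) (_ : Preorder ι) (_ : IsDirectedOrder ι) (_ : Nonempty ι)
    (D : ι → ProjTensorSq A), IsBoundedApproxDiagonal A D

/-- The amenability constant: the infimum of `sup_α ‖D α‖` over all bounded approximate diagonals
`D` of `A`. It is finite exactly when `A` is amenable. -/
def amenabilityConstant : ℝ≥0∞ :=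
  sInf {c | ∃ (ι : Type u) (_ : Preorder ι) (_ : IsDirectedOrder ι) (_ : Nonempty ι)
    (D : ι → ProjTensorSq A), IsBoundedApproxDiagonal A D ∧ c = ⨆ α, ‖D α‖ₑ}

end Amenability

/-! ### The semigroup algebra of a finite semigroup -/

/-- The Banach space `ℓ¹(S)` for a finite set `S`; its norm is `∑ s, ‖x s‖`. -/
def EllOne (S : Type v) [Fintype S] : Type v := PiLp 1 (fun _ : S => ℂ)

namespace EllOne

variable {S : Type v} [Fintype S]

instance : NormedAddCommGroup (EllOne S) :=
  inferInstanceAs (NormedAddCommGroup (PiLp 1 (fun _ : S => ℂ)))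

instance : NormedSpace ℂ (EllOne S) :=
  inferInstanceAs (NormedSpace ℂ (PiLp 1 (fun _ : S => ℂ)))

instance : CompleteSpace (EllOne S) :=
  inferInstanceAs (CompleteSpace (PiLp 1 (fun _ : S => ℂ)))

/-- The coefficient `x(s)`. -/
def coeff (x : EllOne S) (s : S) : ℂ := (show PiLp 1 (fun _ : S => ℂ) from x) s

/-- The element with prescribed coefficients. -/
def mk (f : S → ℂ) : EllOne S := (WithLp.toLp 1 f : PiLp 1 (fun _ : S => ℂ))

@[simp] theorem coeff_mk (f : S → ℂ) (s : S) : (mk f).coeff s = f s := rfl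

@[ext] theorem ext {x y : EllOne S} (h : ∀ s, x.coeff s = y.coeff s) : x = y :=
  PiLp.ext (p := 1) (α := fun _ : S => ℂ) h

@[simp] theorem coeff_zero (s : S) : (0 : EllOne S).coeff s = 0 := rfl

@[simp] theorem coeff_add (x y : EllOne S) (s : S) :
    (x + y).coeff s = x.coeff s + y.coeff s := rfl

@[simp] theorem coeff_smul (c : ℂ) (x : EllOne S) (s : S) :
    (c • x).coeff s = c * x.coeff s := rfl

theorem norm_eq (x : EllOne S) : ‖x‖ = ∑ s, ‖x.coeff s‖ :=
  PiLp.norm_eq_of_L1 (β := fun _ : S => ℂ) x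

open Classical in
/-- Convolution: `(x * y)(r)` is the sum of `x(s) y(t)` over all `s`, `t` with `s * t = r`. -/
instance [Mul S] : Mul (EllOne S) where
  mul x y := mk fun r => ∑ s, ∑ t, if s * t = r then x.coeff s * y.coeff t else 0

open Classical in
theorem coeff_mul [Mul S] (x y : EllOne S) (r : S) :
    (x * y).coeff r = ∑ s, ∑ t, if s * t = r then x.coeff s * y.coeff t else 0 := rfl

/-- Summing a function of `s` against the coefficients of a product. -/
theorem sum_coeff_mul [Mul S] (x y : EllOne S) (f : S → ℂ) :
    ∑ r, (x * y).coeff r * f r = ∑ s, ∑ t, x.coeff s * y.coeff t * f (s * t) := by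
  classical
  simp_rw [coeff_mul, Finset.sum_mul]
  rw [Finset.sum_comm]
  refine Finset.sum_congr rfl fun s _ => ?_
  rw [Finset.sum_comm]
  refine Finset.sum_congr rfl fun t _ => ?_
  simp [ite_mul]

instance [Semigroup S] : NonUnitalNormedRing (EllOne S) where
  left_distrib x y z := by
    classical
    ext r
    simp only [coeff_mul, coeff_add, ← Finset.sum_add_distrib]
    refine Finset.sum_congr rfl fun s _ => Finset.sum_congr rfl fun t _ => ?_
    split_ifs <;> ring
  right_distrib x y z := by
    classical
    ext r
    simp only [coeff_mul, coeff_add, ← Finset.sum_add_distrib]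
    refine Finset.sum_congr rfl fun s _ => Finset.sum_congr rfl fun t _ => ?_
    split_ifs <;> ring
  zero_mul x := by ext r; simp [coeff_mul]
  mul_zero x := by ext r; simp [coeff_mul]
  mul_assoc x y z := by
    classical
    ext r
    have h1 : ((x * y) * z).coeff r
        = ∑ p, (x * y).coeff p * ∑ t, if p * t = r then z.coeff t else 0 := by
      rw [coeff_mul]
      refine Finset.sum_congr rfl fun p _ => ?_
      simp [Finset.mul_sum]
    have h2 : (x * (y * z)).coeff r
        = ∑ s, x.coeff s * ∑ p, (y * z).coeff p * if s * p = r then 1 else 0 := by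
      rw [coeff_mul]
      refine Finset.sum_congr rfl fun p _ => ?_
      simp [Finset.mul_sum]
    rw [h1, h2, sum_coeff_mul]
    refine Finset.sum_congr rfl fun s _ => ?_
    rw [sum_coeff_mul, Finset.mul_sum]
    refine Finset.sum_congr rfl fun t _ => ?_
    simp only [Finset.mul_sum]
    refine Finset.sum_congr rfl fun p _ => ?_
    rw [mul_assoc s t p]
    split_ifs <;> ring
  dist_eq x y := NormedAddGroup.dist_eq x y
  norm_mul_le x y := by
    classical
    rw [norm_eq, norm_eq, norm_eq, Finset.sum_mul_sum]
    calc ∑ r, ‖(x * y).coeff r‖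
        ≤ ∑ r, ∑ s, ∑ t, (if s * t = r then ‖x.coeff s‖ * ‖y.coeff t‖ else 0) := by
          refine Finset.sum_le_sum fun r _ => ?_
          rw [coeff_mul]
          refine (norm_sum_le _ _).trans (Finset.sum_le_sum fun s _ => ?_)
          refine (norm_sum_le _ _).trans (Finset.sum_le_sum fun t _ => ?_)
          split_ifs <;> simp
      _ = ∑ s, ∑ t, ‖x.coeff s‖ * ‖y.coeff t‖ := by
          rw [Finset.sum_comm]
          refine Finset.sum_congr rfl fun s _ => ?_
          rw [Finset.sum_comm]
          refine Finset.sum_congr rfl fun t _ => ?_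
          simp
      _ ≤ _ := le_rfl

instance [Semigroup S] : IsScalarTower ℂ (EllOne S) (EllOne S) where
  smul_assoc c x y := by
    classical
    ext r
    simp only [smul_eq_mul, coeff_mul, coeff_smul, Finset.mul_sum]
    refine Finset.sum_congr rfl fun s _ => Finset.sum_congr rfl fun t _ => ?_
    split_ifs <;> ring

instance [Semigroup S] : SMulCommClass ℂ (EllOne S) (EllOne S) where
  smul_comm c x y := by
    classical
    ext r
    simp only [smul_eq_mul, coeff_mul, coeff_smul, Finset.mul_sum]
    refine Finset.sum_congr rfl fun s _ => Finset.sum_congr rfl fun t _ => ?_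
    split_ifs <;> ring

end EllOne

/-! ### Gradings and the linking assumptions -/

section Graded

variable {S : Type v} [CommSemigroup S] [Fintype S]
  {A : Type u} [NonUnitalNormedRing A] [NormedSpace ℂ A]

/-- `A` is graded over the finite semigroup `S` by the closed subspaces `𝔄 s`: it is their
`ℓ¹`-direct sum, and `𝔄 s * 𝔄 t ⊆ 𝔄 (s * t)`. (Uniqueness of the decomposition follows from the
norm identity.) -/
structure IsGradedBy (𝔄 : S → Submodule ℂ A) : Prop where
  isClosed : ∀ s, IsClosed (𝔄 s : Set A)
  exists_sum : ∀ a : A, ∃ x : ∀ s, 𝔄 s, ∑ s, (x s : A) = a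
  norm_sum : ∀ x : ∀ s, 𝔄 s, ‖∑ s, (x s : A)‖ = ∑ s, ‖(x s : A)‖
  mul_mem : ∀ {s t : S} {a b : A}, a ∈ 𝔄 s → b ∈ 𝔄 t → a * b ∈ 𝔄 (s * t)

variable {𝔄 : S → Submodule ℂ A}

/-- When `S` is idempotent, each graded component is a (closed) subalgebra. -/
def IsGradedBy.component (h : IsGradedBy 𝔄) (hS : ∀ s : S, s * s = s) (s : S) :
    NonUnitalSubalgebra ℂ A :=
  { 𝔄 s with
    mul_mem' := fun {a b} ha hb => by
      have := h.mul_mem ha hb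
      rwa [hS s] at this }

instance (h : IsGradedBy 𝔄) (hS : ∀ s : S, s * s = s) (s : S) :
    NormedSpace ℂ (h.component hS s) where
  norm_smul_le c x := norm_smul_le c (x : A)

instance [CompleteSpace A] (h : IsGradedBy 𝔄) (hS : ∀ s : S, s * s = s) (s : S) :
    CompleteSpace (h.component hS s) :=
  (h.isClosed s).completeSpace_coe

variable (𝔄) in
/-- First linking assumption: each component `𝔄 s` has a bounded approximate identity that is also
an approximate identity for all `𝔄 t` with `t ≤ s`, where `t ≤ s` means `t * s = t`
(the case `t = s` says that it is an approximate identity for `𝔄 s` itself). -/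
def LinkedApproxIdentities : Prop :=
  ∀ s : S, ∃ (ι : Type u) (_ : Preorder ι) (_ : IsDirectedOrder ι) (_ : Nonempty ι) (e : ι → A),
    (∀ α, e α ∈ 𝔄 s) ∧ (∃ C : ℝ, ∀ α, ‖e α‖ ≤ C) ∧
    ∀ t : S, t * s = t → ∀ a ∈ 𝔄 t,
      Tendsto (fun α => e α * a) atTop (𝓝 a) ∧ Tendsto (fun α => a * e α) atTop (𝓝 a)

/-- Second linking assumption: each `𝔄 s` has a contractive character `χ s`, with
`χ (s * t) (a * b) = χ s a * χ t b` for `a ∈ 𝔄 s`, `b ∈ 𝔄 t`. (For `s = t` this identity contains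
the multiplicativity of `χ s`; characters are nonzero.) -/
def IsGradedBy.LinkedCharacters (h : IsGradedBy 𝔄) : Prop :=
  ∃ χ : ∀ s, 𝔄 s →L[ℂ] ℂ, (∀ s, χ s ≠ 0) ∧ (∀ s, ‖χ s‖ ≤ 1) ∧
    ∀ (s t : S) (a : 𝔄 s) (b : 𝔄 t),
      χ (s * t) ⟨(a : A) * (b : A), h.mul_mem a.2 b.2⟩ = χ s a * χ t b

end Graded

end

/-! The two conclusions have independent proofs. Both work with filters on the projective tensor
square instead of nets, so that an iterated limit is simply a `Filter.bind`.

Lower bound. Let `g` be a functional on `A` of norm at most `K` such that every component `𝔄 p`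
contains elements `u` with `g (u x) ≈ g x ≈ g (x u)`, with error at most `δ ‖x‖`, and `g u ≈ 1`.
Then θ : x ⊗ y ↦ ∑ g(x_s y_t) δ_s ⊗ δ_t is bounded by `K`, is compatible with multiplication, and
turns the action of `u` into that of δ_p up to a small error. Hence θ carries a diagonal bounded by
`C` to a diagonal of ℓ¹(S) bounded by `K * C` (`IsLinkedFunctional.isDiagonalFilter_ellOne`), and K
↓ 1 gives the inequality. With linked characters, `g` is their sum over the components. With linked
approximate identities, let z be the zero of S and take g(x) = ψ(b x a) with a, b in the component
of z, chosen so that ψ(ba) = 1 and y ↦ ψ(by) nearly attains its norm on that component in the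
direction of `a`; approximate identities of every component act almost trivially on `a` and `b`.

Amenability. This is the principle that an extension of amenable algebras is amenable, carried out
by explicit tensors in the ℓ¹-unitization. S is exhausted by ideals, each obtained from the previous
one by adjoining one element t. Suppose tensors T with m(T) → 1 asymptotically commute with the
smaller ideal. A diagonal of the component of t, corrected so that its product tends to 1
(`IsDiagonalFilter.isCentralFilter`), gives tensors E = ∑ b ⊗ c. The tensors ∑ b · T · c, with T
running to its limit before E, commute asymptotically with both parts (`IsCentralFilter.sandwich`).
In parallel, elements r = ∏(1 - f) of augmentation 1 that annihilate the ideal in the limit are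
built (`IsAnnihilatingFilter.exists_union_range`), so u = 1 - r is a bounded approximate identity.
Finally u · T · u lies over `A` itself and gives the diagonal (`IsCentralFilter.isDiagonalFilter`).
-/

noncomputable section

/-! ### Elementary tensors and the universal property of the projective tensor square -/

section PureTensor

variable {A : Type u} [NonUnitalNormedRing A] [NormedSpace ℂ A]
variable {E : Type*} [NormedAddCommGroup E] [NormedSpace ℂ E]

/-- The elementary tensor `a ⊗ b` in the projective tensor square. -/
def pureTensor (a b : A) : ProjTensorSq A :=
  ((PiTensorProduct.tprod ℂ ![a, b] : ⨂[ℂ] _ : Fin 2, A) : ProjTensorSq A)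

/-- A bounded bilinear map as a continuous multilinear map on pairs. -/
def bilinearToMultilinear (φ : A →L[ℂ] A →L[ℂ] E) :
    ContinuousMultilinearMap ℂ (fun _ : Fin 2 => A) E :=
  MultilinearMap.mkContinuous
    { toFun := fun x => φ (x 0) (x 1)
      map_update_add' := by
        intro _ m i x y
        fin_cases i <;> simp [Function.update]
      map_update_smul' := by
        intro _ m i c x
        fin_cases i <;> simp [Function.update] }
    ‖φ‖ (fun x => by simpa [mul_assoc] using φ.le_opNorm₂ (x 0) (x 1))

theorem denseRange_toComplL :
    DenseRange (Completion.toComplL : (⨂[ℂ] _ : Fin 2, A) →L[ℂ] ProjTensorSq A) :=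
  Completion.denseRange_coe

theorem isUniformInducing_toComplL :
    IsUniformInducing (Completion.toComplL : (⨂[ℂ] _ : Fin 2, A) →L[ℂ] ProjTensorSq A) :=
  Completion.isUniformInducing_coe _

/-- The projective norm is the largest one with ‖a ⊗ b‖ ≤ ‖a‖ ‖b‖, so bounds on elementary tensors
pass to the algebraic tensor product and, by density, to the completion. Nearly every estimate and
identity for tensors below is reduced to elementary tensors this way. -/
theorem ProjTensorSq.norm_le_of_pureTensor {K : ℝ} (hK : 0 ≤ K) (F : ProjTensorSq A →L[ℂ] E)
    (h : ∀ a b : A, ‖F (pureTensor a b)‖ ≤ K * (‖a‖ * ‖b‖)) (z : ProjTensorSq A) :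
    ‖F z‖ ≤ K * ‖z‖ := by
  induction z using Completion.induction_on with
  | hp => exact isClosed_le (by fun_prop) (by fun_prop)
  | ih w =>
    have h1 := PiTensorProduct.norm_eval_le_projectiveSeminorm
      ((PiTensorProduct.liftIsometry ℂ (fun _ : Fin 2 => A) E).symm
        (F.comp Completion.toComplL)) w
    rw [← PiTensorProduct.liftIsometry_apply_apply, LinearIsometryEquiv.apply_symm_apply] at h1
    rw [Completion.norm_coe]
    refine h1.trans ?_
    gcongr
    refine ContinuousMultilinearMap.opNorm_le_bound hK fun x => ?_
    have hx : ![x 0, x 1] = x := by ext i; fin_cases i <;> rfl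
    simpa [pureTensor, hx] using h (x 0) (x 1)

theorem ProjTensorSq.ext_pureTensor {F G : ProjTensorSq A →L[ℂ] E}
    (h : ∀ a b : A, F (pureTensor a b) = G (pureTensor a b)) (z : ProjTensorSq A) :
    F z = G z := by
  have := ProjTensorSq.norm_le_of_pureTensor le_rfl (F - G) (fun a b => by simp [h]) z
  simpa [sub_eq_zero] using this

/-- The linearization of a bounded bilinear map on the projective tensor square. -/
def ProjTensorSq.lift [CompleteSpace E] (φ : A →L[ℂ] A →L[ℂ] E) : ProjTensorSq A →L[ℂ] E :=
  (PiTensorProduct.liftIsometry ℂ (fun _ : Fin 2 => A) E (bilinearToMultilinear φ)).extend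
    (Completion.toComplL : (⨂[ℂ] _ : Fin 2, A) →L[ℂ] ProjTensorSq A)

@[simp]
theorem ProjTensorSq.lift_pureTensor [CompleteSpace E] (φ : A →L[ℂ] A →L[ℂ] E) (a b : A) :
    ProjTensorSq.lift φ (pureTensor a b) = φ a b := by
  refine (ContinuousLinearMap.extend_eq _ denseRange_toComplL isUniformInducing_toComplL
    (PiTensorProduct.tprod ℂ ![a, b])).trans ?_
  simp [bilinearToMultilinear]

theorem norm_pureTensor_le (a b : A) : ‖pureTensor a b‖ ≤ ‖a‖ * ‖b‖ := by
  rw [pureTensor, Completion.norm_coe]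
  simpa using PiTensorProduct.projectiveSeminorm_tprod_le (𝕜 := ℂ) ![a, b]

theorem pureTensor_add_left (a a' b : A) :
    pureTensor (a + a') b = pureTensor a b + pureTensor a' b := by
  have h := (PiTensorProduct.tprod ℂ (s := fun _ : Fin 2 => A)).map_update_add ![a, b] 0 a a'
  have hu (x : A) : Function.update ![a, b] 0 x = ![x, b] := by
    ext i; fin_cases i <;> simp
  rw [hu, hu, hu] at h
  rw [pureTensor, h, Completion.coe_add]
  rfl

theorem pureTensor_add_right (a b b' : A) :
    pureTensor a (b + b') = pureTensor a b + pureTensor a b' := by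
  have h := (PiTensorProduct.tprod ℂ (s := fun _ : Fin 2 => A)).map_update_add ![a, b] 1 b b'
  have hu (x : A) : Function.update ![a, b] 1 x = ![a, x] := by
    ext i; fin_cases i <;> simp
  rw [hu, hu, hu] at h
  rw [pureTensor, h, Completion.coe_add]
  rfl

theorem pureTensor_smul_left (c : ℂ) (a b : A) :
    pureTensor (c • a) b = c • pureTensor a b := by
  have h := (PiTensorProduct.tprod ℂ (s := fun _ : Fin 2 => A)).map_update_smul ![a, b] 0 c a
  have hu (x : A) : Function.update ![a, b] 0 x = ![x, b] := by
    ext i; fin_cases i <;> simp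
  rw [hu, hu] at h
  rw [pureTensor, h, Completion.coe_smul]
  rfl

theorem pureTensor_smul_right (c : ℂ) (a b : A) :
    pureTensor a (c • b) = c • pureTensor a b := by
  have h := (PiTensorProduct.tprod ℂ (s := fun _ : Fin 2 => A)).map_update_smul ![a, b] 1 c b
  have hu (x : A) : Function.update ![a, b] 1 x = ![a, x] := by
    ext i; fin_cases i <;> simp
  rw [hu, hu] at h
  rw [pureTensor, h, Completion.coe_smul]
  rfl

variable (A) in
/-- The elementary tensor as a bounded bilinear map. -/
def pureTensorL : A →L[ℂ] A →L[ℂ] ProjTensorSq A :=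
  LinearMap.mkContinuous₂
    (LinearMap.mk₂ ℂ pureTensor pureTensor_add_left pureTensor_smul_left
      pureTensor_add_right pureTensor_smul_right) 1
    (fun a b => by simpa using norm_pureTensor_le a b)

@[simp] theorem pureTensorL_apply (a b : A) : pureTensorL A a b = pureTensor a b := rfl

/-- The tensor square of two bounded maps. -/
def ProjTensorSq.map {B : Type v} [NonUnitalNormedRing B] [NormedSpace ℂ B]
    (f g : A →L[ℂ] B) : ProjTensorSq A →L[ℂ] ProjTensorSq B :=
  ProjTensorSq.lift ((pureTensorL B).bilinearComp f g)

@[simp] theorem ProjTensorSq.map_pureTensor {B : Type v} [NonUnitalNormedRing B]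
    [NormedSpace ℂ B] (f g : A →L[ℂ] B) (a b : A) :
    ProjTensorSq.map f g (pureTensor a b) = pureTensor (f a) (g b) := by
  simp [ProjTensorSq.map]

theorem ProjTensorSq.norm_map_le {B : Type v} [NonUnitalNormedRing B]
    [NormedSpace ℂ B] (f g : A →L[ℂ] B) (hf : ∀ a, ‖f a‖ ≤ ‖a‖) (hg : ∀ a, ‖g a‖ ≤ ‖a‖)
    (z : ProjTensorSq A) : ‖ProjTensorSq.map f g z‖ ≤ ‖z‖ := by
  have := ProjTensorSq.norm_le_of_pureTensor zero_le_one (ProjTensorSq.map f g) (fun a b => by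
    rw [map_pureTensor, one_mul]
    refine (norm_pureTensor_le _ _).trans ?_
    gcongr
    exacts [hf a, hg b]) z
  simpa using this

end PureTensor

/-! ### The bimodule structure and the multiplication map -/

section Actions

variable {A : Type u} [NonUnitalNormedRing A] [NormedSpace ℂ A]

theorem completionMap_coe (T : (⨂[ℂ] _ : Fin 2, A) →L[ℂ] (⨂[ℂ] _ : Fin 2, A))
    (w : ⨂[ℂ] _ : Fin 2, A) : completionMap T (w : ProjTensorSq A) = (T w : ProjTensorSq A) :=
  ContinuousLinearMap.extend_eq _ denseRange_toComplL isUniformInducing_toComplL w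

variable [IsScalarTower ℂ A A] [SMulCommClass ℂ A A]

@[simp] theorem leftAct_pureTensor (a b c : A) :
    leftAct a (pureTensor b c) = pureTensor (a * b) c := by
  rw [pureTensor, leftAct, completionMap_coe, pureTensor, PiTensorProduct.mapL_apply,
    PiTensorProduct.map_tprod]
  congr 2
  ext i
  fin_cases i <;> simp

@[simp] theorem rightAct_pureTensor (a b c : A) :
    rightAct a (pureTensor b c) = pureTensor b (c * a) := by
  rw [pureTensor, rightAct, completionMap_coe, pureTensor, PiTensorProduct.mapL_apply,
    PiTensorProduct.map_tprod]
  congr 2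
  ext i
  fin_cases i <;> simp

@[simp] theorem mulMap_pureTensor [CompleteSpace A] (a b : A) :
    mulMap A (pureTensor a b) = a * b := by
  refine (ContinuousLinearMap.extend_eq _ denseRange_toComplL isUniformInducing_toComplL
    (PiTensorProduct.tprod ℂ ![a, b])).trans ?_
  simp [mulMultilinear]

theorem norm_leftAct_le (a : A) (z : ProjTensorSq A) : ‖leftAct a z‖ ≤ ‖a‖ * ‖z‖ :=
  ProjTensorSq.norm_le_of_pureTensor (norm_nonneg a) _ (fun b c => by
    rw [leftAct_pureTensor, ← mul_assoc]
    exact (norm_pureTensor_le _ _).trans (by gcongr; exact norm_mul_le _ _)) z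

theorem norm_rightAct_le (a : A) (z : ProjTensorSq A) : ‖rightAct a z‖ ≤ ‖a‖ * ‖z‖ :=
  ProjTensorSq.norm_le_of_pureTensor (norm_nonneg a) _ (fun b c => by
    rw [rightAct_pureTensor, mul_left_comm, mul_comm ‖a‖]
    exact (norm_pureTensor_le _ _).trans (by gcongr; exact norm_mul_le _ _)) z

theorem norm_mulMap_le [CompleteSpace A] (z : ProjTensorSq A) : ‖mulMap A z‖ ≤ ‖z‖ := by
  simpa using ProjTensorSq.norm_le_of_pureTensor zero_le_one (mulMap A) (fun a b => by
    simpa using norm_mul_le a b) z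

theorem leftAct_add (a b : A) (z : ProjTensorSq A) :
    leftAct (a + b) z = leftAct a z + leftAct b z :=
  ProjTensorSq.ext_pureTensor (F := leftAct (a + b)) (G := leftAct a + leftAct b)
    (fun x y => by simp [add_mul, pureTensor_add_left]) z

theorem leftAct_smul (c : ℂ) (a : A) (z : ProjTensorSq A) :
    leftAct (c • a) z = c • leftAct a z :=
  ProjTensorSq.ext_pureTensor (F := leftAct (c • a)) (G := c • leftAct a)
    (fun x y => by simp [smul_mul_assoc, pureTensor_smul_left]) z

theorem rightAct_add (a b : A) (z : ProjTensorSq A) :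
    rightAct (a + b) z = rightAct a z + rightAct b z :=
  ProjTensorSq.ext_pureTensor (F := rightAct (a + b)) (G := rightAct a + rightAct b)
    (fun x y => by simp [mul_add, pureTensor_add_right]) z

theorem rightAct_smul (c : ℂ) (a : A) (z : ProjTensorSq A) :
    rightAct (c • a) z = c • rightAct a z :=
  ProjTensorSq.ext_pureTensor (F := rightAct (c • a)) (G := c • rightAct a)
    (fun x y => by simp [mul_smul_comm, pureTensor_smul_right]) z

variable (A) in
/-- The left action as a bounded bilinear map. -/
def leftActL : A →L[ℂ] ProjTensorSq A →L[ℂ] ProjTensorSq A :=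
  LinearMap.mkContinuous₂
    (LinearMap.mk₂ ℂ (fun a z => leftAct a z) leftAct_add leftAct_smul
      (fun a => map_add (leftAct a)) (fun c a => map_smul (leftAct a) c)) 1
    (fun a z => by simpa using norm_leftAct_le a z)

variable (A) in
/-- The right action as a bounded bilinear map. -/
def rightActL : A →L[ℂ] ProjTensorSq A →L[ℂ] ProjTensorSq A :=
  LinearMap.mkContinuous₂
    (LinearMap.mk₂ ℂ (fun a z => rightAct a z) rightAct_add rightAct_smul
      (fun a => map_add (rightAct a)) (fun c a => map_smul (rightAct a) c)) 1
    (fun a z => by simpa using norm_rightAct_le a z)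

@[simp] theorem leftActL_apply (a : A) (z : ProjTensorSq A) : leftActL A a z = leftAct a z := rfl

@[simp] theorem rightActL_apply (a : A) (z : ProjTensorSq A) : rightActL A a z = rightAct a z := rfl

theorem leftAct_leftAct (a b : A) (z : ProjTensorSq A) :
    leftAct a (leftAct b z) = leftAct (a * b) z :=
  ProjTensorSq.ext_pureTensor (F := (leftAct a).comp (leftAct b)) (G := leftAct (a * b))
    (fun x y => by simp [mul_assoc]) z

theorem rightAct_rightAct (a b : A) (z : ProjTensorSq A) :
    rightAct a (rightAct b z) = rightAct (b * a) z :=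
  ProjTensorSq.ext_pureTensor (F := (rightAct a).comp (rightAct b)) (G := rightAct (b * a))
    (fun x y => by simp [mul_assoc]) z

theorem leftAct_rightAct (a b : A) (z : ProjTensorSq A) :
    leftAct a (rightAct b z) = rightAct b (leftAct a z) :=
  ProjTensorSq.ext_pureTensor (F := (leftAct a).comp (rightAct b))
    (G := (rightAct b).comp (leftAct a)) (fun x y => by simp) z

theorem mulMap_leftAct [CompleteSpace A] (a : A) (z : ProjTensorSq A) :
    mulMap A (leftAct a z) = a * mulMap A z :=
  ProjTensorSq.ext_pureTensor (F := (mulMap A).comp (leftAct a))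
    (G := (ContinuousLinearMap.mul ℂ A a).comp (mulMap A)) (fun x y => by simp [mul_assoc]) z

theorem mulMap_rightAct [CompleteSpace A] (a : A) (z : ProjTensorSq A) :
    mulMap A (rightAct a z) = mulMap A z * a :=
  ProjTensorSq.ext_pureTensor (F := (mulMap A).comp (rightAct a))
    (G := ((ContinuousLinearMap.mul ℂ A).flip a).comp (mulMap A))
    (fun x y => by simp [mul_assoc]) z

end Actions

/-! ### Approximate diagonals as filters -/

section FilterDiagonal

variable (A : Type u) [NonUnitalNormedRing A] [NormedSpace ℂ A]
  [IsScalarTower ℂ A A] [SMulCommClass ℂ A A] [CompleteSpace A]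

/-- A proper filter on the projective tensor square along which the identity map is a bounded
approximate diagonal, with bound `C`. -/
structure IsDiagonalFilter (l : Filter (ProjTensorSq A)) (C : ℝ) : Prop where
  neBot : l.NeBot
  bounded : ∀ᶠ z in l, ‖z‖ ≤ C
  mul_left : ∀ a : A, Tendsto (fun z => a * mulMap A z) l (𝓝 a)
  mul_right : ∀ a : A, Tendsto (fun z => mulMap A z * a) l (𝓝 a)
  central : ∀ a : A, Tendsto (fun z => leftAct a z - rightAct a z) l (𝓝 0)

variable {A}

theorem IsBoundedApproxDiagonal.isDiagonalFilter {ι : Type*} [Preorder ι] [IsDirectedOrder ι]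
    [Nonempty ι] {D : ι → ProjTensorSq A} (h : IsBoundedApproxDiagonal A D) {C : ℝ}
    (hC : ∀ α, ‖D α‖ ≤ C) : IsDiagonalFilter A (Filter.map D atTop) C where
  neBot := inferInstance
  bounded := eventually_map.2 (Eventually.of_forall hC)
  mul_left a := tendsto_map'_iff.2 (h.mul_left a)
  mul_right a := tendsto_map'_iff.2 (h.mul_right a)
  central a := tendsto_map'_iff.2 (h.central a)

/-- A proper filter containing a set `G` is realized by a net with values in `G`. -/
theorem Filter.exists_net {X : Type u} (l : Filter X) [l.NeBot] {G : Set X} (hG : G ∈ l) :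
    ∃ (ι : Type u) (_ : Preorder ι) (_ : IsDirectedOrder ι) (_ : Nonempty ι) (D : ι → X),
      (∀ α, D α ∈ G) ∧ Tendsto D atTop l := by
  have hne (s : {s : Set X // s ∈ l}ᵒᵈ) : ((OrderDual.ofDual s).1 ∩ G).Nonempty :=
    Filter.nonempty_of_mem (inter_mem (OrderDual.ofDual s).2 hG)
  refine ⟨{s : Set X // s ∈ l}ᵒᵈ, inferInstance, ⟨fun s t => ?_⟩,
    ⟨OrderDual.toDual ⟨G, hG⟩⟩, fun s => (hne s).some, fun s => (hne s).some_mem.2, ?_⟩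
  · exact ⟨OrderDual.toDual (⟨_, inter_mem (OrderDual.ofDual s).2 (OrderDual.ofDual t).2⟩ :
        {s : Set X // s ∈ l}),
      Set.inter_subset_left, Set.inter_subset_right⟩
  · intro s hs
    have := eventually_ge_atTop (OrderDual.toDual (⟨s, hs⟩ : {s : Set X // s ∈ l}))
    exact this.mono fun t ht => ht (hne t).some_mem.1

theorem IsDiagonalFilter.exists_net {l : Filter (ProjTensorSq A)} {C : ℝ}
    (h : IsDiagonalFilter A l C) :
    ∃ (ι : Type u) (_ : Preorder ι) (_ : IsDirectedOrder ι) (_ : Nonempty ι)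
      (D : ι → ProjTensorSq A), IsBoundedApproxDiagonal A D ∧ ∀ α, ‖D α‖ ≤ C := by
  have := h.neBot
  obtain ⟨ι, h1, h2, h3, D, hD, hl⟩ := l.exists_net h.bounded
  exact ⟨ι, h1, h2, h3, D, ⟨⟨C, hD⟩, fun a => (h.mul_left a).comp hl,
    fun a => (h.mul_right a).comp hl, fun a => (h.central a).comp hl⟩, hD⟩

theorem IsDiagonalFilter.isAmenable {l : Filter (ProjTensorSq A)} {C : ℝ}
    (h : IsDiagonalFilter A l C) : IsAmenable A := by
  obtain ⟨ι, h1, h2, h3, D, hD, -⟩ := h.exists_net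
  exact ⟨ι, h1, h2, h3, D, hD⟩

theorem IsDiagonalFilter.amenabilityConstant_le {l : Filter (ProjTensorSq A)} {C : ℝ}
    (h : IsDiagonalFilter A l C) : amenabilityConstant A ≤ ENNReal.ofReal C := by
  obtain ⟨ι, h1, h2, h3, D, hD, hC⟩ := h.exists_net
  have hle : amenabilityConstant A ≤ ⨆ α, ‖D α‖ₑ := sInf_le ⟨ι, h1, h2, h3, D, hD, rfl⟩
  refine hle.trans (iSup_le fun α => ?_)
  rw [← ofReal_norm]
  exact ENNReal.ofReal_le_ofReal (hC α)

theorem IsAmenable.exists_isDiagonalFilter (h : IsAmenable A) :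
    ∃ (l : Filter (ProjTensorSq A)) (C : ℝ), 0 ≤ C ∧ IsDiagonalFilter A l C := by
  obtain ⟨ι, _, _, _, D, hD⟩ := h
  obtain ⟨C, hC⟩ := hD.bounded
  exact ⟨_, C, (norm_nonneg _).trans (hC (Classical.arbitrary ι)), hD.isDiagonalFilter hC⟩

/-- To bound the amenability constant from below it suffices to transport diagonal filters. -/
theorem le_amenabilityConstant {c : ℝ≥0∞}
    (h : ∀ (l : Filter (ProjTensorSq A)) (C : ℝ), 0 ≤ C → IsDiagonalFilter A l C →
      c ≤ ENNReal.ofReal C) : c ≤ amenabilityConstant A := by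
  refine le_sInf ?_
  rintro _ ⟨ι, _, _, _, D, hD, rfl⟩
  obtain ⟨C, hC⟩ := hD.bounded
  have hfin : (⨆ α, ‖D α‖ₑ) ≠ ∞ := by
    refine ((iSup_le fun α => ?_).trans_lt (ENNReal.ofReal_lt_top (r := C))).ne
    rw [← ofReal_norm]
    exact ENNReal.ofReal_le_ofReal (hC α)
  -- The supremum itself, being finite, is used as the bound of the filter, so nothing is lost in
  -- the constant.
  rw [← ENNReal.ofReal_toReal hfin]
  refine h _ _ ENNReal.toReal_nonneg (hD.isDiagonalFilter fun α => ?_)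
  rw [← toReal_enorm]
  exact ENNReal.toReal_mono hfin (le_iSup (fun α => ‖D α‖ₑ) α)

end FilterDiagonal

/-! ### Homogeneous decomposition -/

section Grading

variable {S : Type v} [CommSemigroup S] [Fintype S]
  {A : Type u} [NonUnitalNormedRing A] [NormedSpace ℂ A] {𝔄 : S → Submodule ℂ A}
  {E : Type*} [NormedAddCommGroup E] [NormedSpace ℂ E]

variable (𝔄) in
/-- The sum map from the product of the components to `A`. -/
def sumComponents : (∀ s, 𝔄 s) →ₗ[ℂ] A where
  toFun x := ∑ s, (x s : A)
  map_add' x y := by simp [Finset.sum_add_distrib]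
  map_smul' c x := by simp [Finset.smul_sum]

theorem IsGradedBy.sumComponents_bijective (h : IsGradedBy 𝔄) :
    Function.Bijective (sumComponents 𝔄) := by
  refine ⟨?_, h.exists_sum⟩
  rw [injective_iff_map_eq_zero]
  intro x hx
  have h0 : ∑ s, ‖(x s : A)‖ = 0 := by
    rw [← h.norm_sum x]
    exact norm_eq_zero.2 hx
  rw [Finset.sum_eq_zero_iff_of_nonneg (fun s _ => norm_nonneg _)] at h0
  funext s
  exact Subtype.ext (norm_eq_zero.1 (h0 s (Finset.mem_univ s)))

/-- The linear isomorphism of the product of the components with `A`. -/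
def IsGradedBy.sumEquiv (h : IsGradedBy 𝔄) : (∀ s, 𝔄 s) ≃ₗ[ℂ] A :=
  LinearEquiv.ofBijective (sumComponents 𝔄) h.sumComponents_bijective

theorem IsGradedBy.sumEquiv_apply (h : IsGradedBy 𝔄) (x : ∀ s, 𝔄 s) :
    h.sumEquiv x = ∑ s, (x s : A) := rfl

theorem IsGradedBy.norm_eq_sum (h : IsGradedBy 𝔄) (a : A) :
    ‖a‖ = ∑ s, ‖(h.sumEquiv.symm a s : A)‖ := by
  rw [← h.norm_sum, ← h.sumEquiv_apply, LinearEquiv.apply_symm_apply]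

/-- The projection of `A` onto a graded component. -/
def IsGradedBy.proj (h : IsGradedBy 𝔄) (s : S) : A →L[ℂ] 𝔄 s :=
  LinearMap.mkContinuous ((LinearMap.proj s).comp h.sumEquiv.symm.toLinearMap) 1 (fun a => by
    rw [h.norm_eq_sum a, one_mul]
    exact Finset.single_le_sum (f := fun s => ‖(h.sumEquiv.symm a s : A)‖)
      (fun s _ => norm_nonneg _) (Finset.mem_univ s))

theorem IsGradedBy.sum_norm_proj (h : IsGradedBy 𝔄) (a : A) : ∑ s, ‖h.proj s a‖ = ‖a‖ :=
  (h.norm_eq_sum a).symm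

theorem IsGradedBy.sum_proj (h : IsGradedBy 𝔄) (a : A) : ∑ s, (h.proj s a : A) = a :=
  h.sumEquiv.apply_symm_apply a

open Classical in
theorem IsGradedBy.proj_of_mem (h : IsGradedBy 𝔄) {a : A} {s : S} (ha : a ∈ 𝔄 s) :
    (fun t => h.proj t a) = Pi.single s ⟨a, ha⟩ := by
  apply h.sumEquiv.injective
  refine (h.sumEquiv.apply_symm_apply a).trans ?_
  rw [h.sumEquiv_apply, Finset.sum_eq_single s]
  · simp
  · intro t _ hts
    simp [hts]
  · simp

/-- Serves to evaluate maps defined component by component on homogeneous elements, where a single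
summand survives. -/
theorem IsGradedBy.sum_proj_of_mem (h : IsGradedBy 𝔄) {a : A} {s : S} (ha : a ∈ 𝔄 s)
    {M : Type*} [AddCommMonoid M] (f : S → A → M) (hf : ∀ t, f t 0 = 0) :
    ∑ t, f t (h.proj t a : A) = f s a := by
  classical
  have hp (t : S) : h.proj t a = (Pi.single s ⟨a, ha⟩ : ∀ t, 𝔄 t) t :=
    congrFun (h.proj_of_mem ha) t
  rw [Finset.sum_eq_single s]
  · rw [hp s, Pi.single_eq_same]
  · intro t _ hts
    rw [hp t, Pi.single_eq_of_ne hts]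
    exact hf t
  · simp

/-- This is where the ℓ¹-norm of the direct sum matters: the triangle inequality over the components
loses nothing. -/
theorem IsGradedBy.norm_le_of_homogeneous (h : IsGradedBy 𝔄) {K : ℝ}
    (F : A →L[ℂ] E) (hF : ∀ s, ∀ a ∈ 𝔄 s, ‖F a‖ ≤ K * ‖a‖) (a : A) : ‖F a‖ ≤ K * ‖a‖ := by
  conv_lhs => rw [← h.sum_proj a]
  rw [map_sum, ← h.sum_norm_proj, Finset.mul_sum]
  exact norm_sum_le_of_le _ fun s _ => hF s _ (h.proj s a).2

/-- The projective square of an ℓ¹-sum is the ℓ¹-sum of the products of its components; the proof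
applies the preceding lemma in one tensor factor at a time. -/
theorem IsGradedBy.norm_le_of_homogeneous_tensor (h : IsGradedBy 𝔄) {K : ℝ} (hK : 0 ≤ K)
    (F : ProjTensorSq A →L[ℂ] E)
    (hF : ∀ s t, ∀ a ∈ 𝔄 s, ∀ b ∈ 𝔄 t, ‖F (pureTensor a b)‖ ≤ K * (‖a‖ * ‖b‖))
    (z : ProjTensorSq A) : ‖F z‖ ≤ K * ‖z‖ := by
  refine ProjTensorSq.norm_le_of_pureTensor hK F (fun a b => ?_) z
  have h1 (a : A) : ∀ t, ∀ b ∈ 𝔄 t, ‖F (pureTensor a b)‖ ≤ K * (‖a‖ * ‖b‖) := by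
    intro t b hb
    have := h.norm_le_of_homogeneous (K := K * ‖b‖) (F.comp ((pureTensorL A).flip b))
      (fun s a ha => by
        refine (hF s t a ha b hb).trans_eq ?_
        ring) a
    refine this.trans_eq ?_
    ring
  have := h.norm_le_of_homogeneous (K := K * ‖a‖) (F.comp (pureTensorL A a))
    (fun t b hb => (h1 a t b hb).trans_eq (by ring)) b
  exact this.trans_eq (by ring)

end Grading

/-! ### Point masses in ℓ¹(S) -/

namespace EllOne

variable {S : Type v} [Fintype S]

open Classical in
/-- The point mass at `s`. -/
def single (s : S) : EllOne S := mk (Pi.single s 1)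

theorem norm_single (s : S) : ‖single s‖ = 1 := by
  classical
  rw [norm_eq, Finset.sum_eq_single s]
  · simp [single]
  · intro t _ ht
    simp [single, ht]
  · simp

theorem coeff_sum {ι : Type*} (I : Finset ι) (f : ι → EllOne S) (t : S) :
    (∑ i ∈ I, f i).coeff t = ∑ i ∈ I, (f i).coeff t := by
  classical
  induction I using Finset.induction_on with
  | empty => simp
  | insert i I hi ih => simp [Finset.sum_insert hi, ih]

theorem eq_sum_single (x : EllOne S) : x = ∑ s, x.coeff s • single s := by
  classical
  ext t
  rw [coeff_sum, Finset.sum_eq_single t]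
  · simp [single]
  · intro s _ hs
    simp [single, hs.symm]
  · simp

theorem single_mul_single [Semigroup S] (s t : S) : single s * single t = single (s * t) := by
  classical
  ext r
  rw [coeff_mul, Finset.sum_eq_single s, Finset.sum_eq_single t]
  · simp [single, Pi.single_apply, eq_comm]
  · intro b _ hb
    simp [single, hb]
  · simp
  · intro b _ hb
    simp [single, hb]
  · simp

theorem mul_comm' [CommSemigroup S] (x y : EllOne S) : x * y = y * x := by
  classical
  ext r
  rw [coeff_mul, coeff_mul, Finset.sum_comm]
  refine Finset.sum_congr rfl fun s _ => Finset.sum_congr rfl fun t _ => ?_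
  rw [mul_comm s t, mul_comm (x.coeff t)]

/-- A limit that is linear in an element of `ℓ¹(S)` may be checked on point masses. -/
theorem tendsto_of_single {X E : Type*} [NormedAddCommGroup E] [NormedSpace ℂ E]
    {l : Filter X} (F : X → EllOne S →ₗ[ℂ] E) (G : EllOne S →ₗ[ℂ] E)
    (h : ∀ s, Tendsto (fun z => F z (single s)) l (𝓝 (G (single s)))) (x : EllOne S) :
    Tendsto (fun z => F z x) l (𝓝 (G x)) := by
  rw [eq_sum_single x]
  simp only [map_sum, map_smul]
  exact tendsto_finsetSum _ fun s _ => (h s).const_smul _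

end EllOne

/-! ### Transport of diagonals from `A` to ℓ¹(S) -/

section Transport

variable {S : Type v} [CommSemigroup S] [Fintype S]
  {A : Type u} [NonUnitalNormedRing A] [NormedSpace ℂ A] {𝔄 : S → Submodule ℂ A}

/-- The map `a ↦ ∑ s, g (a s) δ_s` from `A` to `ℓ¹(S)`. -/
def IsGradedBy.toEllOne (h : IsGradedBy 𝔄) (g : A →L[ℂ] ℂ) : A →L[ℂ] EllOne S :=
  ∑ s, (g.comp ((𝔄 s).subtypeL.comp (h.proj s))).smulRight (EllOne.single s)

theorem IsGradedBy.toEllOne_of_mem (h : IsGradedBy 𝔄) (g : A →L[ℂ] ℂ) {s : S} {a : A}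
    (ha : a ∈ 𝔄 s) : h.toEllOne g a = g a • EllOne.single s := by
  have := h.sum_proj_of_mem ha (fun t x => g x • (EllOne.single t : EllOne S)) (by simp)
  rw [← this]
  simp [toEllOne]

variable [IsScalarTower ℂ A A] [SMulCommClass ℂ A A]

/-- The map `x ⊗ y ↦ ∑ s t, g (x s * y t) δ_s ⊗ δ_t` from the tensor square of `A` to that of
`ℓ¹(S)`. -/
def IsGradedBy.tensorToEllOne (h : IsGradedBy 𝔄) (g : A →L[ℂ] ℂ) :
    ProjTensorSq A →L[ℂ] ProjTensorSq (EllOne S) :=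
  ∑ s, ∑ t, ProjTensorSq.lift
    ((ContinuousLinearMap.compL ℂ A A (ProjTensorSq (EllOne S))
      (g.smulRight (pureTensor (EllOne.single s) (EllOne.single t)))).comp
      ((ContinuousLinearMap.mul ℂ A).bilinearComp ((𝔄 s).subtypeL.comp (h.proj s))
        ((𝔄 t).subtypeL.comp (h.proj t))))

theorem IsGradedBy.tensorToEllOne_of_mem (h : IsGradedBy 𝔄) (g : A →L[ℂ] ℂ) {s t : S} {a b : A}
    (ha : a ∈ 𝔄 s) (hb : b ∈ 𝔄 t) : h.tensorToEllOne g (pureTensor a b)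
      = g (a * b) • pureTensor (EllOne.single s) (EllOne.single t) := by
  have h1 (x : A) := h.sum_proj_of_mem hb (fun t y => fun s : S =>
    g (x * y) • pureTensor (EllOne.single s : EllOne S) (EllOne.single t))
    (fun t => by funext s; simp)
  have h2 := h.sum_proj_of_mem ha
    (fun s x => g (x * b) • pureTensor (EllOne.single s : EllOne S) (EllOne.single t)) (by simp)
  rw [← h2, tensorToEllOne]
  simp only [sum_apply]
  refine Finset.sum_congr rfl fun r _ => ?_
  have := congrFun (h1 (h.proj r a)) r
  rw [← this, Finset.sum_apply]
  exact Finset.sum_congr rfl fun q _ => by simp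

theorem norm_pureTensor_single_le (s t : S) :
    ‖pureTensor (EllOne.single s : EllOne S) (EllOne.single t)‖ ≤ 1 :=
  (norm_pureTensor_le _ _).trans_eq (by rw [EllOne.norm_single, EllOne.norm_single, mul_one])

theorem IsGradedBy.norm_tensorToEllOne_le (h : IsGradedBy 𝔄) {g : A →L[ℂ] ℂ} {K : ℝ}
    (hK : 0 ≤ K) (hg : ∀ x, ‖g x‖ ≤ K * ‖x‖) (z : ProjTensorSq A) :
    ‖h.tensorToEllOne g z‖ ≤ K * ‖z‖ := by
  refine h.norm_le_of_homogeneous_tensor hK _ (fun s t a ha b hb => ?_) z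
  rw [h.tensorToEllOne_of_mem g ha hb, norm_smul]
  calc _ ≤ ‖g (a * b)‖ * 1 := by gcongr; exact norm_pureTensor_single_le s t
    _ ≤ K * ‖a * b‖ := by rw [mul_one]; exact hg _
    _ ≤ _ := by gcongr; exact norm_mul_le a b

/-- Since u has degree p, on a ⊗ b of degrees s, t both terms are multiples of δ_{ps} ⊗ δ_t, with
coefficients g(ab) and g(u(ab)); near-invariance of `g` compares them. -/
theorem IsGradedBy.norm_leftAct_tensorToEllOne_sub_le (h : IsGradedBy 𝔄) {g : A →L[ℂ] ℂ} {p : S}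
    {u : A} (hu : u ∈ 𝔄 p) {δ : ℝ} (hδ : 0 ≤ δ) (hg : ∀ x, ‖g (u * x) - g x‖ ≤ δ * ‖x‖)
    (z : ProjTensorSq A) :
    ‖leftAct (EllOne.single p) (h.tensorToEllOne g z) - h.tensorToEllOne g (leftAct u z)‖
      ≤ δ * ‖z‖ := by
  refine h.norm_le_of_homogeneous_tensor hδ ((leftAct (EllOne.single p)).comp
    (h.tensorToEllOne g) - (h.tensorToEllOne g).comp (leftAct u)) (fun s t a ha b hb => ?_) z
  rw [sub_apply, ContinuousLinearMap.comp_apply,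
    ContinuousLinearMap.comp_apply, h.tensorToEllOne_of_mem g ha hb, map_smul,
    leftAct_pureTensor, leftAct_pureTensor, h.tensorToEllOne_of_mem g (h.mul_mem hu ha) hb,
    EllOne.single_mul_single, ← sub_smul, norm_smul, mul_assoc]
  calc _ ≤ ‖g (a * b) - g (u * (a * b))‖ * 1 := by gcongr; exact norm_pureTensor_single_le _ t
    _ ≤ δ * ‖a * b‖ := by rw [mul_one, norm_sub_rev]; exact hg _
    _ ≤ _ := by gcongr; exact norm_mul_le a b

theorem IsGradedBy.norm_rightAct_tensorToEllOne_sub_le (h : IsGradedBy 𝔄) {g : A →L[ℂ] ℂ} {p : S}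
    {u : A} (hu : u ∈ 𝔄 p) {δ : ℝ} (hδ : 0 ≤ δ) (hg : ∀ x, ‖g (x * u) - g x‖ ≤ δ * ‖x‖)
    (z : ProjTensorSq A) :
    ‖rightAct (EllOne.single p) (h.tensorToEllOne g z) - h.tensorToEllOne g (rightAct u z)‖
      ≤ δ * ‖z‖ := by
  refine h.norm_le_of_homogeneous_tensor hδ ((rightAct (EllOne.single p)).comp
    (h.tensorToEllOne g) - (h.tensorToEllOne g).comp (rightAct u)) (fun s t a ha b hb => ?_) z
  rw [sub_apply, ContinuousLinearMap.comp_apply,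
    ContinuousLinearMap.comp_apply, h.tensorToEllOne_of_mem g ha hb, map_smul,
    rightAct_pureTensor, rightAct_pureTensor, h.tensorToEllOne_of_mem g ha (h.mul_mem hb hu),
    EllOne.single_mul_single, ← sub_smul, norm_smul, ← mul_assoc]
  calc _ ≤ ‖g (a * b) - g ((a * b) * u)‖ * 1 := by gcongr; exact norm_pureTensor_single_le s _
    _ ≤ δ * ‖a * b‖ := by rw [mul_one, norm_sub_rev]; exact hg _
    _ ≤ _ := by gcongr; exact norm_mul_le a b

theorem IsGradedBy.norm_single_mul_toEllOne_sub_le (h : IsGradedBy 𝔄) {g : A →L[ℂ] ℂ} {p : S}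
    {u : A} (hu : u ∈ 𝔄 p) {δ : ℝ} (hg : ∀ x, ‖g (u * x) - g x‖ ≤ δ * ‖x‖) (x : A) :
    ‖EllOne.single p * h.toEllOne g x - h.toEllOne g (u * x)‖ ≤ δ * ‖x‖ := by
  refine h.norm_le_of_homogeneous ((ContinuousLinearMap.mul ℂ (EllOne S) (EllOne.single p)).comp
    (h.toEllOne g) - (h.toEllOne g).comp (ContinuousLinearMap.mul ℂ A u)) (fun s a ha => ?_) x
  simp only [sub_apply, ContinuousLinearMap.comp_apply,
    ContinuousLinearMap.mul_apply', h.toEllOne_of_mem g ha,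
    h.toEllOne_of_mem g (h.mul_mem hu ha), mul_smul_comm, EllOne.single_mul_single, ← sub_smul,
    norm_smul, EllOne.norm_single, mul_one]
  rw [norm_sub_rev]
  exact hg a

/-- The coefficient in `tensorToEllOne` is g(ab), not g(a) g(b), precisely so that this identity is
exact without multiplicativity of `g`. -/
theorem IsGradedBy.mulMap_tensorToEllOne [CompleteSpace A] (h : IsGradedBy 𝔄) (g : A →L[ℂ] ℂ)
    (z : ProjTensorSq A) : mulMap _ (h.tensorToEllOne g z) = h.toEllOne g (mulMap A z) := by
  rw [← sub_eq_zero, ← norm_le_zero_iff]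
  refine (h.norm_le_of_homogeneous_tensor (K := 0) le_rfl
    ((mulMap _).comp (h.tensorToEllOne g) - (h.toEllOne g).comp (mulMap A))
    (fun s t a ha b hb => ?_) z).trans_eq (zero_mul _)
  rw [zero_mul, norm_le_zero_iff, sub_apply, ContinuousLinearMap.comp_apply,
    ContinuousLinearMap.comp_apply, h.tensorToEllOne_of_mem g ha hb, map_smul,
    mulMap_pureTensor, mulMap_pureTensor, h.toEllOne_of_mem g (h.mul_mem ha hb),
    EllOne.single_mul_single, sub_self]

variable (𝔄) in
/-- A functional of norm at most `K` which is asymptotically fixed by multiplication with suitable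
elements of each component. -/
structure IsLinkedFunctional (g : A →L[ℂ] ℂ) (K : ℝ) : Prop where
  norm_le : ∀ x, ‖g x‖ ≤ K * ‖x‖
  exists_unit : ∀ (p : S) (δ : ℝ), 0 < δ → ∃ u ∈ 𝔄 p, (∀ x, ‖g (u * x) - g x‖ ≤ δ * ‖x‖) ∧
    (∀ x, ‖g (x * u) - g x‖ ≤ δ * ‖x‖) ∧ ‖g u - 1‖ ≤ δ

theorem IsLinkedFunctional.tendsto_single_mul [CompleteSpace A] {g : A →L[ℂ] ℂ} {K : ℝ}
    (hg : IsLinkedFunctional 𝔄 g K) (h : IsGradedBy 𝔄) {l : Filter (ProjTensorSq A)} {C : ℝ}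
    (hC : 0 ≤ C) (hl : IsDiagonalFilter A l C) (p : S) :
    Tendsto (fun z => EllOne.single p * mulMap _ (h.tensorToEllOne g z)) l
      (𝓝 (EllOne.single p)) := by
  rw [Metric.tendsto_nhds]
  intro ε hε
  -- With θ₁ = `h.toEllOne g`, the chain is δ_p θ₁(m z) ≈ θ₁(u m z) ≈ θ₁(u) ≈ δ_p. The first and
  -- last errors add up to at most δ C + δ = ε/2 for this δ; the middle one tends to zero along the
  -- diagonal.
  obtain ⟨u, hu, hul, -, hu1⟩ := hg.exists_unit p (ε / (2 * (C + 1))) (by positivity)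
  have hlim : Tendsto (fun z => ‖h.toEllOne g (u * mulMap A z) - h.toEllOne g u‖) l (𝓝 0) :=
    tendsto_iff_norm_sub_tendsto_zero.1 (((h.toEllOne g).continuous.tendsto u).comp
      (hl.mul_left u))
  filter_upwards [hl.bounded, hlim.eventually (gt_mem_nhds (half_pos hε))] with z hz hz1
  have h1 := h.norm_single_mul_toEllOne_sub_le hu hul (mulMap A z)
  have h2 : ‖h.toEllOne g u - EllOne.single p‖ ≤ ε / (2 * (C + 1)) := by
    rw [h.toEllOne_of_mem g hu]
    nth_rewrite 2 [← one_smul ℂ (EllOne.single p)]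
    rw [← sub_smul, norm_smul, EllOne.norm_single, mul_one]
    exact hu1
  have h3 : ε / (2 * (C + 1)) * ‖mulMap A z‖ ≤ ε / (2 * (C + 1)) * C := by
    gcongr
    exact (norm_mulMap_le z).trans hz
  rw [h.mulMap_tensorToEllOne, dist_eq_norm,
    show EllOne.single p * h.toEllOne g (mulMap A z) - EllOne.single p
      = (EllOne.single p * h.toEllOne g (mulMap A z) - h.toEllOne g (u * mulMap A z))
        + (h.toEllOne g (u * mulMap A z) - h.toEllOne g u)
        + (h.toEllOne g u - EllOne.single p) by abel]
  refine (norm_add₃_le).trans_lt ?_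
  have h4 : ε / (2 * (C + 1)) * C + ε / (2 * (C + 1)) = ε / 2 := by field_simp
  linarith

theorem IsLinkedFunctional.tendsto_single_central [CompleteSpace A] {g : A →L[ℂ] ℂ} {K : ℝ}
    (hg : IsLinkedFunctional 𝔄 g K) (h : IsGradedBy 𝔄) {l : Filter (ProjTensorSq A)} {C : ℝ}
    (hC : 0 ≤ C) (hl : IsDiagonalFilter A l C) (p : S) :
    Tendsto (fun z => leftAct (EllOne.single p) (h.tensorToEllOne g z)
      - rightAct (EllOne.single p) (h.tensorToEllOne g z)) l (𝓝 0) := by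
  rw [Metric.tendsto_nhds]
  intro ε hε
  have hδ : 0 ≤ ε / (4 * (C + 1)) := by positivity
  obtain ⟨u, hu, hul, hur, -⟩ := hg.exists_unit p (ε / (4 * (C + 1))) (by positivity)
  have hlim := (((h.tensorToEllOne g).continuous.tendsto _).comp (hl.central u)).norm
  rw [map_zero, norm_zero] at hlim
  filter_upwards [hl.bounded, hlim.eventually (gt_mem_nhds (half_pos hε))] with z hz hz1
  have h1 := h.norm_leftAct_tensorToEllOne_sub_le hu hδ hul z
  have h2 := h.norm_rightAct_tensorToEllOne_sub_le hu hδ hur z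
  rw [norm_sub_rev] at h2
  have h3 : ε / (4 * (C + 1)) * ‖z‖ ≤ ε / (4 * (C + 1)) * C := by gcongr
  rw [Function.comp_apply, map_sub] at hz1
  -- The intermediate points b and c are left open here and supplied below: the images of u · z and
  -- z · u.
  rw [dist_zero_right, show ∀ a b c d : ProjTensorSq (EllOne S),
    a - d = (a - b) + (b - c) + (c - d) by intros; abel]
  refine (norm_add₃_le).trans_lt ?_
  rotate_left
  · exact h.tensorToEllOne g (leftAct u z)
  · exact h.tensorToEllOne g (rightAct u z)
  have h4 : ε / (4 * (C + 1)) * C + ε / (4 * (C + 1)) * C < ε / 2 := by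
    rw [← mul_add, div_mul_eq_mul_div, div_lt_div_iff₀ (by positivity) (by positivity)]
    nlinarith
  linarith

theorem IsLinkedFunctional.isDiagonalFilter_ellOne [CompleteSpace A] {g : A →L[ℂ] ℂ} {K : ℝ}
    (hg : IsLinkedFunctional 𝔄 g K) (hK : 0 ≤ K) (h : IsGradedBy 𝔄)
    {l : Filter (ProjTensorSq A)} {C : ℝ} (hC : 0 ≤ C) (hl : IsDiagonalFilter A l C) :
    IsDiagonalFilter (EllOne S) (l.map (h.tensorToEllOne g)) (K * C) := by
  have hmul (x : EllOne S) :
      Tendsto (fun z => x * mulMap _ (h.tensorToEllOne g z)) l (𝓝 x) :=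
    EllOne.tendsto_of_single
      (fun z => ((ContinuousLinearMap.mul ℂ (EllOne S)).flip
        (mulMap _ (h.tensorToEllOne g z))).toLinearMap) LinearMap.id
      (hg.tendsto_single_mul h hC hl) x
  have := hl.neBot
  refine ⟨inferInstance, ?_, fun x => tendsto_map'_iff.2 (hmul x),
    fun x => tendsto_map'_iff.2 ?_, fun x => tendsto_map'_iff.2 ?_⟩
  · refine eventually_map.2 (hl.bounded.mono fun z hz => ?_)
    exact (h.norm_tensorToEllOne_le hK hg.norm_le z).trans (by gcongr)
  · simpa only [Function.comp_def, EllOne.mul_comm' _ x] using hmul x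
  · exact EllOne.tendsto_of_single
      (fun z => ((leftActL (EllOne S)).flip (h.tensorToEllOne g z)
        - (rightActL (EllOne S)).flip (h.tensorToEllOne g z)).toLinearMap) 0
      (hg.tendsto_single_central h hC hl) x

/-- A functional is needed for each K > 1 only, because a norm need not be attained; the factor K
disappears in the limit K ↓ 1. -/
theorem amenabilityConstant_ellOne_le [CompleteSpace A] (h : IsGradedBy 𝔄)
    (hg : ∀ K : ℝ, 1 < K → ∃ g : A →L[ℂ] ℂ, IsLinkedFunctional 𝔄 g K) :
    amenabilityConstant (EllOne S) ≤ amenabilityConstant A := by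
  refine le_amenabilityConstant fun l C hC hl => ?_
  have hlim : Tendsto (fun K : ℝ => ENNReal.ofReal (K * C)) (𝓝[>] 1)
      (𝓝 (ENNReal.ofReal (1 * C))) :=
    ((ENNReal.continuous_ofReal.comp (continuous_mul_const C)).tendsto 1).mono_left
      nhdsWithin_le_nhds
  rw [one_mul] at hlim
  refine ge_of_tendsto hlim ?_
  filter_upwards [self_mem_nhdsWithin] with K hK
  obtain ⟨g, hg⟩ := hg K hK
  exact (hg.isDiagonalFilter_ellOne (zero_le_one.trans (le_of_lt hK)) h hC
    hl).amenabilityConstant_le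

end Transport

/-! ### Linked functionals from either linking assumption -/

section LinkedFunctionals

variable {S : Type v} [CommSemigroup S] [Fintype S]
  {A : Type u} [NonUnitalNormedRing A] [NormedSpace ℂ A]
  [IsScalarTower ℂ A A] [SMulCommClass ℂ A A] {𝔄 : S → Submodule ℂ A}

/-- The characters add up to one multiplicative functional on `A`, contractive because the sum is
ℓ¹. An element of the component of p normalized to value 1 then leaves it exactly invariant. -/
theorem IsGradedBy.LinkedCharacters.exists_isLinkedFunctional {h : IsGradedBy 𝔄}
    (hχ : h.LinkedCharacters) {K : ℝ} (hK : 1 < K) :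
    ∃ g : A →L[ℂ] ℂ, IsLinkedFunctional 𝔄 g K := by
  obtain ⟨χ, hne, hle, hmul⟩ := hχ
  let g : A →L[ℂ] ℂ := ∑ s, (χ s).comp (h.proj s)
  have hg {s : S} {a : A} (ha : a ∈ 𝔄 s) : g a = χ s ⟨a, ha⟩ := by
    classical
    have hp (t : S) : h.proj t a = (Pi.single s ⟨a, ha⟩ : ∀ t, 𝔄 t) t :=
      congrFun (h.proj_of_mem ha) t
    simp only [g, sum_apply, ContinuousLinearMap.comp_apply]
    rw [Finset.sum_eq_single s]
    · rw [hp s, Pi.single_eq_same]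
    · intro t _ hts
      rw [hp t, Pi.single_eq_of_ne hts, map_zero]
    · simp
  have hgmul {s t : S} {a b : A} (ha : a ∈ 𝔄 s) (hb : b ∈ 𝔄 t) : g (a * b) = g a * g b := by
    rw [hg (h.mul_mem ha hb), hg ha, hg hb]
    exact hmul s t ⟨a, ha⟩ ⟨b, hb⟩
  refine ⟨g, h.norm_le_of_homogeneous g fun s a ha => ?_, fun p δ hδ => ?_⟩
  · rw [hg ha]
    refine ((χ s).le_of_opNorm_le (hle s) _).trans ?_
    exact mul_le_mul_of_nonneg_right hK.le (norm_nonneg a)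
  · obtain ⟨v, hv⟩ := DFunLike.ne_iff.1 (hne p)
    rw [zero_apply] at hv
    have hu : (χ p v)⁻¹ • (v : A) ∈ 𝔄 p := (𝔄 p).smul_mem _ v.2
    have hu1 : g ((χ p v)⁻¹ • (v : A)) = 1 := by
      rw [map_smul, hg v.2, smul_eq_mul]
      exact inv_mul_cancel₀ hv
    refine ⟨_, hu, fun x => ?_, fun x => ?_, by simpa [hu1] using hδ.le⟩
    · refine h.norm_le_of_homogeneous
        (g.comp (ContinuousLinearMap.mul ℂ A ((χ p v)⁻¹ • (v : A))) - g) (fun s a ha => ?_) x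
      rw [sub_apply, ContinuousLinearMap.comp_apply, ContinuousLinearMap.mul_apply', hgmul hu ha,
        hu1, one_mul, sub_self, norm_zero]
      positivity
    · refine h.norm_le_of_homogeneous
        (g.comp ((ContinuousLinearMap.mul ℂ A).flip ((χ p v)⁻¹ • (v : A))) - g)
        (fun s a ha => ?_) x
      rw [sub_apply, ContinuousLinearMap.comp_apply, ContinuousLinearMap.flip_apply,
        ContinuousLinearMap.mul_apply', hgmul ha hu, hu1, mul_one, sub_self, norm_zero]
      positivity

/-- A finite nonempty semilattice has a zero. -/
theorem exists_absorbing (hS : ∀ s : S, s * s = s) [Nonempty S] : ∃ z : S, ∀ s, z * s = z := by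
  classical
  have (I : Finset S) : ∃ z : S, ∀ s ∈ I, z * s = z := by
    induction I using Finset.induction_on with
    | empty => exact ⟨Classical.arbitrary S, by simp⟩
    | insert r I _ ih =>
      obtain ⟨z, hz⟩ := ih
      -- The zero is the product of all elements, accumulated one factor at a time.
      refine ⟨z * r, fun s hs => ?_⟩
      rcases Finset.mem_insert.1 hs with rfl | hs
      · rw [mul_assoc, hS]
      · rw [mul_right_comm, hz s hs]
  obtain ⟨z, hz⟩ := this Finset.univ
  exact ⟨z, fun s => hz s (Finset.mem_univ s)⟩

/-- A nonzero functional almost attains its norm. -/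
theorem ContinuousLinearMap.exists_apply_eq_one {V : Type*} [NormedAddCommGroup V]
    [NormedSpace ℂ V] {f : V →L[ℂ] ℂ} (hf : f ≠ 0) {K : ℝ} (hK : 1 < K) :
    ∃ a, f a = 1 ∧ ‖f‖ * ‖a‖ ≤ K := by
  have hlt : ‖f‖ / K < ‖f‖ := div_lt_self (norm_pos_iff.2 hf) hK
  have hK0 : 0 < K := zero_lt_one.trans hK
  by_contra! hcon
  refine hlt.not_ge (f.opNorm_le_bound (by positivity) fun v => ?_)
  by_cases hv : f v = 0
  · rw [hv, norm_zero]
    positivity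
  · have := hcon ((f v)⁻¹ • v) (by rw [map_smul, smul_eq_mul, inv_mul_cancel₀ hv])
    rw [norm_smul, norm_inv] at this
    have hpos := norm_pos_iff.2 hv
    rw [div_mul_eq_mul_div, le_div_iff₀ hK0]
    rw [mul_left_comm, ← div_eq_inv_mul, lt_div_iff₀ hpos] at this
    linarith

/-- Every p lies above the zero z, so approximate identities of all components act on the component
of z. Placing elements of that component on both sides of the argument turns this pointwise
convergence into invariance uniform on bounded sets. -/
theorem LinkedApproxIdentities.exists_isLinkedFunctional (hS : ∀ s : S, s * s = s)
    (h : IsGradedBy 𝔄) (hne : ∀ s, 𝔄 s ≠ ⊥) (hu : LinkedApproxIdentities 𝔄) {K : ℝ}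
    (hK : 1 < K) : ∃ g : A →L[ℂ] ℂ, IsLinkedFunctional 𝔄 g K := by
  rcases isEmpty_or_nonempty S with hS0 | hS0
  · refine ⟨0, fun x => ?_, fun p => isEmptyElim p⟩
    rw [zero_apply, norm_zero]
    positivity
  obtain ⟨z, hz⟩ := exists_absorbing hS
  have happrox (p : S) (a b : A) (ha : a ∈ 𝔄 z) (hb : b ∈ 𝔄 z) (δ : ℝ) (hδ : 0 < δ) :
      ∃ u ∈ 𝔄 p, ‖u * a - a‖ < δ ∧ ‖b * u - b‖ < δ := by
    obtain ⟨ι, _, _, _, e, he, -, hlim⟩ := hu p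
    have h1 := tendsto_iff_norm_sub_tendsto_zero.1 (hlim z (hz p) a ha).1
    have h2 := tendsto_iff_norm_sub_tendsto_zero.1 (hlim z (hz p) b hb).2
    obtain ⟨α, h1, h2⟩ := ((h1.eventually (gt_mem_nhds hδ)).and
      (h2.eventually (gt_mem_nhds hδ))).exists
    exact ⟨e α, he α, h1, h2⟩
  obtain ⟨a₀, ha₀, ha₀0⟩ := Submodule.exists_mem_ne_zero_of_ne_bot (hne z)
  -- An error smaller than ‖a₀‖ forces b a₀ ≠ 0.
  obtain ⟨b, hb, hba, -⟩ := happrox z a₀ a₀ ha₀ ha₀ ‖a₀‖ (norm_pos_iff.2 ha₀0)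
  have hb0 : b * a₀ ≠ 0 := fun h0 => by
    rw [h0, zero_sub, norm_neg] at hba
    exact lt_irrefl _ hba
  obtain ⟨ψ, hψ1, hψ⟩ := exists_dual_vector ℂ (b * a₀) (norm_ne_zero_iff.2 hb0)
  -- The norm of f is taken on the component of z only. This suffices because that component absorbs
  -- products, so g(x) = f(x a) and ‖g‖ ≤ ‖f‖ ‖a‖ ≤ K.
  let f : 𝔄 z →L[ℂ] ℂ := (ψ.comp (ContinuousLinearMap.mul ℂ A b)).comp (𝔄 z).subtypeL
  have hf : f ≠ 0 := fun h0 => by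
    have : ψ (b * a₀) = 0 := congrArg (fun F : 𝔄 z →L[ℂ] ℂ => F ⟨a₀, ha₀⟩) h0
    rw [hψ] at this
    exact hb0 (norm_eq_zero.1 (Complex.ofReal_eq_zero.1 this))
  obtain ⟨⟨a, ha⟩, hfa, hnorm⟩ := ContinuousLinearMap.exists_apply_eq_one hf hK
  have hfa : ψ (b * a) = 1 := hfa
  have hnorm : ‖f‖ * ‖a‖ ≤ K := hnorm
  have hmem (x : A) : x * a ∈ 𝔄 z := by
    rw [← h.sum_proj x, Finset.sum_mul]
    refine (𝔄 z).sum_mem fun s _ => ?_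
    have := h.mul_mem (h.proj s x).2 ha
    rwa [mul_comm, hz s] at this
  let g : A →L[ℂ] ℂ := (ψ.comp (ContinuousLinearMap.mul ℂ A b)).comp
    ((ContinuousLinearMap.mul ℂ A).flip a)
  have hg (x : A) : g x = ψ (b * (x * a)) := rfl
  have hψ_le (x : A) : ‖ψ x‖ ≤ ‖x‖ := (ψ.le_of_opNorm_le hψ1.le x).trans_eq (one_mul _)
  refine ⟨g, fun x => ?_, fun p δ hδ => ?_⟩
  · calc ‖g x‖ = ‖f ⟨x * a, hmem x⟩‖ := rfl
      _ ≤ ‖f‖ * ‖x * a‖ := f.le_opNorm _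
      _ ≤ ‖f‖ * (‖x‖ * ‖a‖) := by gcongr; exact norm_mul_le x a
      _ = ‖f‖ * ‖a‖ * ‖x‖ := by ring
      _ ≤ K * ‖x‖ := by gcongr
  · obtain ⟨u, hu, hua, hub⟩ := happrox p a b ha hb (δ / (‖a‖ + ‖b‖ + 1)) (by positivity)
    have hAδ : δ / (‖a‖ + ‖b‖ + 1) * ‖a‖ ≤ δ := by
      rw [div_mul_eq_mul_div, div_le_iff₀ (by positivity)]
      gcongr
      linarith [norm_nonneg b]
    have hBδ : ‖b‖ * (δ / (‖a‖ + ‖b‖ + 1)) ≤ δ := by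
      rw [mul_div_assoc', div_le_iff₀ (by positivity), mul_comm]
      gcongr
      linarith [norm_nonneg a]
    refine ⟨u, hu, fun x => ?_, fun x => ?_, ?_⟩
    · rw [hg, hg, ← map_sub, show b * (u * x * a) - b * (x * a) = (b * u - b) * (x * a) by
        noncomm_ring]
      calc _ ≤ ‖(b * u - b) * (x * a)‖ := hψ_le _
        _ ≤ ‖b * u - b‖ * (‖x‖ * ‖a‖) := norm_mul_le_of_le le_rfl (norm_mul_le x a)
        _ ≤ δ / (‖a‖ + ‖b‖ + 1) * (‖x‖ * ‖a‖) := by gcongr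
        _ = δ / (‖a‖ + ‖b‖ + 1) * ‖a‖ * ‖x‖ := by ring
        _ ≤ δ * ‖x‖ := by gcongr
    · rw [hg, hg, ← map_sub, show b * (x * u * a) - b * (x * a) = b * (x * (u * a - a)) by
        noncomm_ring]
      calc _ ≤ ‖b * (x * (u * a - a))‖ := hψ_le _
        _ ≤ ‖b‖ * (‖x‖ * ‖u * a - a‖) := norm_mul_le_of_le le_rfl (norm_mul_le x _)
        _ ≤ ‖b‖ * (‖x‖ * (δ / (‖a‖ + ‖b‖ + 1))) := by gcongr
        _ = ‖b‖ * (δ / (‖a‖ + ‖b‖ + 1)) * ‖x‖ := by ring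
        _ ≤ δ * ‖x‖ := by gcongr
    · rw [hg, ← hfa, ← map_sub, ← mul_sub]
      calc _ ≤ ‖b * (u * a - a)‖ := hψ_le _
        _ ≤ ‖b‖ * ‖u * a - a‖ := norm_mul_le _ _
        _ ≤ ‖b‖ * (δ / (‖a‖ + ‖b‖ + 1)) := by gcongr
        _ ≤ δ := hBδ

end LinkedFunctionals

/-! ### Iterated limits along `Filter.bind` -/

section IteratedLimits

theorem Filter.neBot_bind {α β : Type*} {l : Filter α} [l.NeBot] {m : α → Filter β}
    (hm : ∀ a, (m a).NeBot) : (l.bind m).NeBot := by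
  refine ⟨fun h => ?_⟩
  have h0 : ∅ ∈ l.bind m := by rw [h]; exact mem_bot
  obtain ⟨s, hs, hs'⟩ := Filter.mem_bind.1 h0
  obtain ⟨a, ha⟩ := Filter.nonempty_of_mem hs
  exact (hm a).ne (Filter.empty_mem_iff_bot.1 (hs' a ha))

/-- An iterated limit whose inner limits are off by an error tending to zero. -/
theorem Filter.tendsto_bind_of_norm_le {α β E : Type*} [SeminormedAddCommGroup E] {l : Filter α}
    {m : α → Filter β} {h : β → E} {y : E} {r : α → ℝ} (hr : Tendsto r l (𝓝 0))
    (hh : ∀ᶠ a in l, ∀ ε > 0, ∀ᶠ b in m a, ‖h b - y‖ ≤ r a + ε) :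
    Tendsto h (l.bind m) (𝓝 y) := by
  rw [Metric.tendsto_nhds]
  intro ε hε
  rw [Filter.eventually_bind]
  filter_upwards [hh, hr.eventually (gt_mem_nhds (half_pos hε))] with a ha hra
  filter_upwards [ha (ε / 4) (by positivity)] with b hb
  rw [dist_eq_norm]
  linarith

end IteratedLimits

/-! ### Density arguments for tensors -/

section PureTensorLimits

variable {A : Type u} [NonUnitalNormedRing A] [NormedSpace ℂ A]
  {E : Type*} [NormedAddCommGroup E] [NormedSpace ℂ E]

theorem ProjTensorSq.induction {p : ProjTensorSq A → Prop} (hclosed : IsClosed {z | p z})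
    (hadd : ∀ z w, p z → p w → p (z + w)) (hsmul : ∀ (c : ℂ) z, p z → p (c • z))
    (hpure : ∀ a b, p (pureTensor a b)) (z : ProjTensorSq A) : p z := by
  induction z using Completion.induction_on with
  | hp => exact hclosed
  | ih w =>
    induction w using PiTensorProduct.induction_on with
    | smul_tprod c x =>
      have hx : ![x 0, x 1] = x := by ext i; fin_cases i <;> rfl
      rw [Completion.coe_smul, ← hx]
      exact hsmul c _ (hpure _ _)
    | add v w hv hw =>
      rw [Completion.coe_add]
      exact hadd _ _ hv hw

/-- For an eventually uniformly bounded family of operators, the vectors on which it tends to zero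
form a closed set. -/
theorem isClosed_setOf_tendsto_zero {X F : Type*} [NormedAddCommGroup F] [NormedSpace ℂ F]
    {l : Filter X} (H : X → F →L[ℂ] E) {K : ℝ} (hK : ∀ᶠ i in l, ∀ z, ‖H i z‖ ≤ K * ‖z‖) :
    IsClosed {z | Tendsto (fun i => H i z) l (𝓝 0)} := by
  refine isClosed_of_closure_subset fun z hz => ?_
  rw [Set.mem_ofPred_eq, Metric.tendsto_nhds]
  intro ε hε
  obtain ⟨w, hw, hzw⟩ := Metric.mem_closure_iff.1 hz (ε / (2 * (|K| + 1))) (by positivity)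
  filter_upwards [hK, (Metric.tendsto_nhds.1 hw) (ε / 2) (by positivity)] with i hi hwi
  rw [dist_zero_right] at hwi ⊢
  have h1 : ‖H i (z - w)‖ ≤ (|K| + 1) * (ε / (2 * (|K| + 1))) := by
    refine (hi _).trans ?_
    rw [← dist_eq_norm]
    gcongr
    linarith [le_abs_self K]
  have h2 : (|K| + 1) * (ε / (2 * (|K| + 1))) = ε / 2 := by field_simp
  calc ‖H i z‖ = ‖H i (z - w) + H i w‖ := by rw [← map_add, sub_add_cancel]
    _ ≤ ‖H i (z - w)‖ + ‖H i w‖ := norm_add_le _ _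
    _ < ε := by linarith

end PureTensorLimits

/-! ### The sandwich product of two tensors -/

section Sandwich

variable {U : Type u} [NormedRing U] [NormedAlgebra ℂ U]

/-- The map `b ⊗ c ↦ b · T · c`. -/
def sandwich (T : ProjTensorSq U) : ProjTensorSq U →L[ℂ] ProjTensorSq U :=
  ProjTensorSq.lift ((leftActL U).bilinearComp (ContinuousLinearMap.id ℂ U)
    ((rightActL U).flip T))

theorem sandwich_pureTensor (T : ProjTensorSq U) (b c : U) :
    sandwich T (pureTensor b c) = leftAct b (rightAct c T) := by
  simp [sandwich]

theorem norm_sandwich_le (T D : ProjTensorSq U) : ‖sandwich T D‖ ≤ ‖T‖ * ‖D‖ :=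
  ProjTensorSq.norm_le_of_pureTensor (norm_nonneg T) _ (fun b c => by
    rw [sandwich_pureTensor]
    calc _ ≤ ‖b‖ * (‖c‖ * ‖T‖) :=
          (norm_leftAct_le _ _).trans (by gcongr; exact norm_rightAct_le _ _)
      _ = _ := by ring) D

/-- The outer legs come from D, so `sandwich T` is a bimodule map in D and centrality of D is
inherited. -/
theorem leftAct_sandwich (a : U) (T D : ProjTensorSq U) :
    leftAct a (sandwich T D) = sandwich T (leftAct a D) :=
  ProjTensorSq.ext_pureTensor (F := (leftAct a).comp (sandwich T))
    (G := (sandwich T).comp (leftAct a))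
    (fun b c => by simp [sandwich_pureTensor, leftAct_leftAct]) D

theorem rightAct_sandwich (a : U) (T D : ProjTensorSq U) :
    rightAct a (sandwich T D) = sandwich T (rightAct a D) :=
  ProjTensorSq.ext_pureTensor (F := (rightAct a).comp (sandwich T))
    (G := (sandwich T).comp (rightAct a))
    (fun b c => by simp [sandwich_pureTensor, ← leftAct_rightAct, rightAct_rightAct]) D

theorem norm_mulMap_sandwich_sub_le [CompleteSpace U] (T D : ProjTensorSq U) :
    ‖mulMap U (sandwich T D) - mulMap U D‖ ≤ ‖mulMap U T - 1‖ * ‖D‖ :=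
  ProjTensorSq.norm_le_of_pureTensor (norm_nonneg _) ((mulMap U).comp (sandwich T) - mulMap U)
    (fun b c => by
      rw [sub_apply, ContinuousLinearMap.comp_apply, sandwich_pureTensor, mulMap_leftAct,
        mulMap_rightAct, mulMap_pureTensor,
        show b * (mulMap U T * c) - b * c = b * (mulMap U T - 1) * c by noncomm_ring]
      calc _ ≤ ‖b‖ * ‖mulMap U T - 1‖ * ‖c‖ := norm_mul₃_le
        _ = _ := by ring) D

end Sandwich

/-! ### Asymptotically central tensors in a unital algebra -/

section CentralFilters

variable {U : Type u} [NormedRing U] [NormedAlgebra ℂ U]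

/-- The elements which asymptotically commute with the tensors of a filter. -/
def asymptoticCentralizer (l : Filter (ProjTensorSq U)) : Submodule ℂ U where
  carrier := {a | Tendsto (fun z => leftAct a z - rightAct a z) l (𝓝 0)}
  zero_mem' := by
    have (z : ProjTensorSq U) : leftAct (0 : U) z - rightAct (0 : U) z = 0 := by
      rw [← leftActL_apply, ← rightActL_apply, map_zero, map_zero]
      simp
    simpa only [Set.mem_ofPred_eq, this] using tendsto_const_nhds
  add_mem' {a b} ha hb := by
    have := Tendsto.add ha hb
    rw [add_zero] at this
    refine this.congr fun z => ?_
    rw [leftAct_add, rightAct_add]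
    abel
  smul_mem' c a ha := by
    have := Tendsto.const_smul ha c
    rw [smul_zero] at this
    refine this.congr fun z => ?_
    rw [leftAct_smul, rightAct_smul, smul_sub]

theorem mem_asymptoticCentralizer {l : Filter (ProjTensorSq U)} {a : U} :
    a ∈ asymptoticCentralizer l ↔ Tendsto (fun z => leftAct a z - rightAct a z) l (𝓝 0) := Iff.rfl

/-- The closed span of the elementary tensors with entries in `W`. -/
def closedTensorSpan (W : Set U) : Submodule ℂ (ProjTensorSq U) :=
  (Submodule.span ℂ (Set.image2 pureTensor W W)).topologicalClosure

theorem pureTensor_mem_closedTensorSpan {W : Set U} {b c : U} (hb : b ∈ W) (hc : c ∈ W) :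
    pureTensor b c ∈ closedTensorSpan W :=
  Submodule.le_topologicalClosure _ (Submodule.subset_span (Set.mem_image2_of_mem hb hc))

theorem map_mem_closedTensorSpan {B : Type u} [NonUnitalNormedRing B] [NormedSpace ℂ B]
    {φ : B →L[ℂ] U} {W : Set U} (hφ : ∀ b, φ b ∈ W) (z : ProjTensorSq B) :
    ProjTensorSq.map φ φ z ∈ closedTensorSpan W := by
  induction z using ProjTensorSq.induction with
  | hclosed =>
    exact (Submodule.isClosed_topologicalClosure _).preimage (ProjTensorSq.map φ φ).continuous
  | hadd z w hz hw => rw [map_add]; exact add_mem hz hw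
  | hsmul c z hz => rw [map_smul]; exact Submodule.smul_mem _ c hz
  | hpure a b =>
    rw [ProjTensorSq.map_pureTensor]
    exact pureTensor_mem_closedTensorSpan (hφ a) (hφ b)

theorem tendsto_zero_of_mem_closedTensorSpan {X E : Type*} [NormedAddCommGroup E]
    [NormedSpace ℂ E] {l : Filter X} {W : Set U} (H : X → ProjTensorSq U →L[ℂ] E) {K : ℝ}
    (hK : ∀ᶠ i in l, ∀ z, ‖H i z‖ ≤ K * ‖z‖)
    (h : ∀ b ∈ W, ∀ c ∈ W, Tendsto (fun i => H i (pureTensor b c)) l (𝓝 0))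
    {z : ProjTensorSq U} (hz : z ∈ closedTensorSpan W) :
    Tendsto (fun i => H i z) l (𝓝 0) := by
  refine (closure_minimal (fun w hw => ?_) (isClosed_setOf_tendsto_zero H hK) :
    closure _ ⊆ {z | Tendsto (fun i => H i z) l (𝓝 0)}) hz
  induction hw using Submodule.span_induction with
  | mem w hw =>
    obtain ⟨b, hb, c, hc, rfl⟩ := hw
    exact h b hb c hc
  | zero => simpa using! tendsto_const_nhds
  | add v w _ _ hv hw => simpa using! Tendsto.add hv hw
  | smul c v _ hv => simpa using! Tendsto.const_smul hv c

variable [CompleteSpace U]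

/-- A bounded filter of tensors with products tending to `1`, asymptotically commuting with `V`. -/
structure IsCentralFilter (V : Set U) (l : Filter (ProjTensorSq U)) (C : ℝ) : Prop where
  neBot : l.NeBot
  bounded : ∀ᶠ z in l, ‖z‖ ≤ C
  tendsto_mulMap : Tendsto (mulMap U) l (𝓝 1)
  central : V ⊆ asymptoticCentralizer l

/-- For E = b ⊗ c, j · (b · T · c) = (jb) · T · c, and jb can be moved across T in the limit, which
gives T · (jbc). Boundedness of T extends this to the closed span. -/
theorem IsCentralFilter.tendsto_leftAct_sandwich {V W : Set U} {l : Filter (ProjTensorSq U)} {C : ℝ}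
    (hl : IsCentralFilter V l C) {j : U} (hW : ∀ b ∈ W, j * b ∈ asymptoticCentralizer l)
    {E : ProjTensorSq U} (hE : E ∈ closedTensorSpan W) :
    Tendsto (fun T => leftAct j (sandwich T E) - rightAct (j * mulMap U E) T) l (𝓝 0) := by
  refine tendsto_zero_of_mem_closedTensorSpan (K := ‖j‖ * C + C * ‖j‖)
    (fun T => (leftAct j).comp (sandwich T)
      - (((rightActL U).flip T).comp (ContinuousLinearMap.mul ℂ U j)).comp (mulMap U))
    (hl.bounded.mono fun T hT z => ?_) (fun b hb c _ => ?_) hE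
  · refine (norm_sub_le _ _).trans ?_
    rw [add_mul]
    refine add_le_add ?_ ?_
    · calc _ ≤ ‖j‖ * (‖T‖ * ‖z‖) :=
            (norm_leftAct_le _ _).trans (by gcongr; exact norm_sandwich_le T z)
        _ ≤ ‖j‖ * (C * ‖z‖) := by gcongr
        _ = _ := by ring
    · calc _ ≤ ‖j * mulMap U z‖ * ‖T‖ := norm_rightAct_le _ _
        _ ≤ (‖j‖ * ‖z‖) * C := by
            gcongr
            exact (norm_mul_le _ _).trans (by gcongr; exact norm_mulMap_le z)
        _ = _ := by ring
  · have := ((rightAct c).continuous.tendsto _).comp (mem_asymptoticCentralizer.1 (hW b hb))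
    rw [map_zero] at this
    refine this.congr fun T => ?_
    simp [sandwich_pureTensor, leftAct_leftAct, leftAct_rightAct, rightAct_rightAct, mul_assoc]

theorem IsCentralFilter.tendsto_rightAct_sandwich {V W : Set U} {l : Filter (ProjTensorSq U)} {C : ℝ}
    (hl : IsCentralFilter V l C) {j : U} (hW : ∀ b ∈ W, b * j ∈ asymptoticCentralizer l)
    {E : ProjTensorSq U} (hE : E ∈ closedTensorSpan W) :
    Tendsto (fun T => rightAct j (sandwich T E) - leftAct (mulMap U E * j) T) l (𝓝 0) := by
  refine tendsto_zero_of_mem_closedTensorSpan (K := ‖j‖ * C + C * ‖j‖)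
    (fun T => (rightAct j).comp (sandwich T)
      - (((leftActL U).flip T).comp ((ContinuousLinearMap.mul ℂ U).flip j)).comp (mulMap U))
    (hl.bounded.mono fun T hT z => ?_) (fun b _ c hc => ?_) hE
  · refine (norm_sub_le _ _).trans ?_
    rw [add_mul]
    refine add_le_add ?_ ?_
    · calc _ ≤ ‖j‖ * (‖T‖ * ‖z‖) :=
            (norm_rightAct_le _ _).trans (by gcongr; exact norm_sandwich_le T z)
        _ ≤ ‖j‖ * (C * ‖z‖) := by gcongr
        _ = _ := by ring
    · calc _ ≤ ‖mulMap U z * j‖ * ‖T‖ := norm_leftAct_le _ _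
        _ ≤ (‖z‖ * ‖j‖) * C := by
            gcongr
            exact (norm_mul_le _ _).trans (by gcongr; exact norm_mulMap_le z)
        _ = _ := by ring
  · have := ((leftAct b).continuous.tendsto _).comp (mem_asymptoticCentralizer.1 (hW c hc)).neg
    rw [neg_zero, map_zero] at this
    refine this.congr fun T => ?_
    simp [sandwich_pureTensor, leftAct_leftAct, ← leftAct_rightAct, rightAct_rightAct, mul_assoc]

/-- Sandwiching the tensors of a central filter for `V` into those of a central filter for `W₀`
yields a central filter for `V ∪ W₀`, if the entries of the latter do not lead out of the
asymptotic centralizer. -/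
theorem IsCentralFilter.sandwich {V W₀ W : Set U} {l k : Filter (ProjTensorSq U)} {C K : ℝ}
    (hl : IsCentralFilter V l C) (hk : IsCentralFilter W₀ k K)
    (hkW : ∀ᶠ E in k, E ∈ closedTensorSpan W)
    (hleft : ∀ j ∈ V, ∀ b ∈ W, j * b ∈ asymptoticCentralizer l)
    (hright : ∀ j ∈ V, ∀ b ∈ W, b * j ∈ asymptoticCentralizer l) :
    IsCentralFilter (V ∪ W₀) (k.bind fun E => l.map fun T => _root_.sandwich T E) (C * K) := by
  have := hl.neBot
  have := hk.neBot
  have hC : 0 ≤ C := by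
    obtain ⟨z, hz⟩ := hl.bounded.exists
    exact (norm_nonneg z).trans hz
  refine ⟨Filter.neBot_bind fun _ => inferInstance, ?_, ?_, ?_⟩
  · rw [Filter.eventually_bind]
    filter_upwards [hk.bounded] with E hE
    rw [eventually_map]
    filter_upwards [hl.bounded] with T hT
    exact (norm_sandwich_le T E).trans (by gcongr)
  · refine Filter.tendsto_bind_of_norm_le
      (tendsto_iff_norm_sub_tendsto_zero.1 hk.tendsto_mulMap) (Eventually.of_forall ?_)
    intro E ε hε
    have h1 := (tendsto_iff_norm_sub_tendsto_zero.1 hl.tendsto_mulMap).mul_const ‖E‖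
    rw [zero_mul] at h1
    rw [eventually_map]
    filter_upwards [h1.eventually (gt_mem_nhds hε)] with T hT
    have h2 := norm_mulMap_sandwich_sub_le T E
    have h3 := norm_sub_le_norm_sub_add_norm_sub (mulMap U (_root_.sandwich T E)) (mulMap U E) 1
    linarith
  · rintro j (hj | hj)
    -- For fixed E the commutator with j tends to T · (j m(E)) - (m(E) j) · T. This differs from T ·
    -- j - j · T, itself tending to zero, by at most the quantity shown here.
    · have hr : Tendsto (fun E => C * (‖mulMap U E * j - j‖ + ‖j * mulMap U E - j‖)) k (𝓝 0) := by
        have h1 := tendsto_iff_norm_sub_tendsto_zero.1 (hk.tendsto_mulMap.mul_const j)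
        have h2 := tendsto_iff_norm_sub_tendsto_zero.1 (hk.tendsto_mulMap.const_mul j)
        simpa using (h1.add h2).const_mul C
      refine Filter.tendsto_bind_of_norm_le hr ?_
      filter_upwards [hkW] with E hE ε hε
      have h1 := hl.tendsto_leftAct_sandwich (hleft j hj) hE
      have h2 := hl.tendsto_rightAct_sandwich (hright j hj) hE
      have h3 := ((h1.sub h2).sub (hl.central hj)).norm
      rw [sub_zero, sub_zero, norm_zero] at h3
      rw [eventually_map]
      filter_upwards [hl.bounded, h3.eventually (gt_mem_nhds hε)] with T hT hTε
      have h4 : ‖leftAct (mulMap U E * j - j) T‖ ≤ ‖mulMap U E * j - j‖ * C :=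
        (norm_leftAct_le _ _).trans (by gcongr)
      have h5 : ‖rightAct (j * mulMap U E - j) T‖ ≤ ‖j * mulMap U E - j‖ * C :=
        (norm_rightAct_le _ _).trans (by gcongr)
      rw [← leftActL_apply, map_sub, sub_apply, leftActL_apply, leftActL_apply] at h4
      rw [← rightActL_apply, map_sub, sub_apply, rightActL_apply, rightActL_apply] at h5
      rw [sub_zero]
      have h6 : leftAct j (_root_.sandwich T E) - rightAct j (_root_.sandwich T E)
          = (leftAct j (_root_.sandwich T E) - rightAct (j * mulMap U E) T
              - (rightAct j (_root_.sandwich T E) - leftAct (mulMap U E * j) T)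
              - (leftAct j T - rightAct j T))
            + (rightAct (j * mulMap U E) T - rightAct j T)
            - (leftAct (mulMap U E * j) T - leftAct j T) := by abel
      rw [h6]
      refine (norm_sub_le _ _).trans ?_
      have h7 := norm_add_le (leftAct j (_root_.sandwich T E) - rightAct (j * mulMap U E) T
              - (rightAct j (_root_.sandwich T E) - leftAct (mulMap U E * j) T)
              - (leftAct j T - rightAct j T)) (rightAct (j * mulMap U E) T - rightAct j T)
      linarith
    · refine Filter.tendsto_bind_of_norm_le (r := fun E => C * ‖leftAct j E - rightAct j E‖) ?_
        (Eventually.of_forall fun E ε hε => ?_)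
      · simpa using (mem_asymptoticCentralizer.1 (hk.central hj)).norm.const_mul C
      · rw [eventually_map]
        filter_upwards [hl.bounded] with T hT
        rw [leftAct_sandwich, rightAct_sandwich, ← map_sub, sub_zero]
        refine (norm_sandwich_le _ _).trans ?_
        calc _ ≤ C * ‖leftAct j E - rightAct j E‖ := by gcongr
          _ ≤ _ := by linarith

end CentralFilters

/-! ### Correcting a diagonal so that its product tends to the unit -/

section UnitalDiagonal

theorem norm_mul_sub_mul_unitCorrection_le {B : Type*} [NonUnitalNormedRing B] {C : ℝ} {f : B}
    (hf : ‖f‖ ≤ C) (a : B) :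
    ‖a * (f + f - f * f) - (f + f - f * f) * a‖
      ≤ (1 + C) * (‖a * f - a‖ + ‖f * a - a‖) := by
  have h1 : a * (f + f - f * f) - (f + f - f * f) * a
      = ((a * f - a) - (a * f - a) * f) - ((f * a - a) - f * (f * a - a)) := by noncomm_ring
  have h2 : ‖(a * f - a) * f‖ ≤ ‖a * f - a‖ * C := norm_mul_le_of_le le_rfl hf
  have h3 : ‖f * (f * a - a)‖ ≤ C * ‖f * a - a‖ := norm_mul_le_of_le hf le_rfl
  rw [h1]
  refine (norm_sub_le _ _).trans ((add_le_add (norm_sub_le _ _) (norm_sub_le _ _)).trans ?_)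
  linarith

variable {U : Type u} [NormedRing U] [NormedAlgebra ℂ U]
  {B : Type u} [NonUnitalNormedRing B] [NormedSpace ℂ B] [IsScalarTower ℂ B B]
  [SMulCommClass ℂ B B]

theorem leftAct_map {φ : B →L[ℂ] U} (hφ : ∀ a b, φ (a * b) = φ a * φ b) (a : B)
    (z : ProjTensorSq B) :
    leftAct (φ a) (ProjTensorSq.map φ φ z) = ProjTensorSq.map φ φ (leftAct a z) :=
  ProjTensorSq.ext_pureTensor (F := (leftAct (φ a)).comp (ProjTensorSq.map φ φ))
    (G := (ProjTensorSq.map φ φ).comp (leftAct a)) (fun x y => by simp [hφ]) z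

theorem rightAct_map {φ : B →L[ℂ] U} (hφ : ∀ a b, φ (a * b) = φ a * φ b) (a : B)
    (z : ProjTensorSq B) :
    rightAct (φ a) (ProjTensorSq.map φ φ z) = ProjTensorSq.map φ φ (rightAct a z) :=
  ProjTensorSq.ext_pureTensor (F := (rightAct (φ a)).comp (ProjTensorSq.map φ φ))
    (G := (ProjTensorSq.map φ φ).comp (rightAct a)) (fun x y => by simp [hφ]) z

theorem mulMap_map [CompleteSpace U] [CompleteSpace B] {φ : B →L[ℂ] U}
    (hφ : ∀ a b, φ (a * b) = φ a * φ b) (z : ProjTensorSq B) :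
    mulMap U (ProjTensorSq.map φ φ z) = φ (mulMap B z) :=
  ProjTensorSq.ext_pureTensor (F := (mulMap U).comp (ProjTensorSq.map φ φ))
    (G := φ.comp (mulMap B)) (fun x y => by simp [hφ]) z

/-- The correction of the image in `U` of a tensor `D` over a subalgebra to a tensor whose product
is close to `1`, by means of an approximate unit `f` of the subalgebra. -/
def unitalDiagonal (φ : B →L[ℂ] U) (f : B) (D : ProjTensorSq B) : ProjTensorSq U :=
  ProjTensorSq.map φ φ (rightAct (f + f - f * f) D) + pureTensor (1 - φ f) (1 - φ f)

/-- Put g = 2f - f². The second summand contributes (1 - φ f)² = 1 - φ g, which explains the factor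
g attached to D: the product is 1 up to m(D) g - g. -/
theorem mulMap_unitalDiagonal [CompleteSpace U] [CompleteSpace B] {φ : B →L[ℂ] U}
    (hφ : ∀ a b, φ (a * b) = φ a * φ b) (f : B) (D : ProjTensorSq B) :
    mulMap U (unitalDiagonal φ f D) - 1
      = φ (mulMap B D * (f + f - f * f) - (f + f - f * f)) := by
  rw [unitalDiagonal, map_add, mulMap_map hφ, mulMap_rightAct, mulMap_pureTensor, map_sub,
    map_sub φ (f + f), map_add, hφ f f]
  noncomm_ring

theorem norm_unitalDiagonal_le {φ : B →L[ℂ] U} (hle : ∀ b, ‖φ b‖ ≤ ‖b‖) {C : ℝ} {f : B}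
    {D : ProjTensorSq B} (hf : ‖f‖ ≤ C) (hD : ‖D‖ ≤ C) :
    ‖unitalDiagonal φ f D‖ ≤ (C + C + C * C) * C + (‖(1 : U)‖ + C) * (‖(1 : U)‖ + C) := by
  have hC : 0 ≤ C := (norm_nonneg f).trans hf
  have h1 : ‖(1 : U) - φ f‖ ≤ ‖(1 : U)‖ + C :=
    (norm_sub_le _ _).trans (by gcongr; exact (hle f).trans hf)
  refine (norm_add_le _ _).trans (add_le_add ?_ ?_)
  · refine (ProjTensorSq.norm_map_le φ φ hle hle _).trans ((norm_rightAct_le _ _).trans ?_)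
    have h2 : ‖f + f - f * f‖ ≤ C + C + C * C :=
      (norm_sub_le _ _).trans (add_le_add (norm_add_le_of_le hf hf) (norm_mul_le_of_le hf hf))
    gcongr
  · exact (norm_pureTensor_le _ _).trans (by gcongr)

/-- With g = 2f - f², the commutator splits into the images of (a · D - D · a) · g and D · (ag - ga)
and two elementary tensors with legs φ(af - a), φ(fa - a). Only the first is not controlled by f,
and it vanishes as D varies with f fixed. Hence f is chosen in the outer limit. -/
theorem norm_commutator_unitalDiagonal_le {φ : B →L[ℂ] U} (hφ : ∀ a b, φ (a * b) = φ a * φ b)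
    (hle : ∀ b, ‖φ b‖ ≤ ‖b‖) {C : ℝ} {f : B} {D : ProjTensorSq B} (hf : ‖f‖ ≤ C) (hD : ‖D‖ ≤ C)
    (a : B) :
    ‖leftAct (φ a) (unitalDiagonal φ f D) - rightAct (φ a) (unitalDiagonal φ f D)‖
      ≤ ((1 + C) * C + (‖(1 : U)‖ + C)) * (‖a * f - a‖ + ‖f * a - a‖)
        + ‖rightAct (f + f - f * f) (leftAct a D - rightAct a D)‖ := by
  have hC : 0 ≤ C := (norm_nonneg f).trans hf
  set g := f + f - f * f with hg
  have h1 : ‖(1 : U) - φ f‖ ≤ ‖(1 : U)‖ + C :=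
    (norm_sub_le _ _).trans (by gcongr; exact (hle f).trans hf)
  have h2 : leftAct (φ a) (unitalDiagonal φ f D) - rightAct (φ a) (unitalDiagonal φ f D)
      = ProjTensorSq.map φ φ (rightAct g (leftAct a D - rightAct a D))
        + ProjTensorSq.map φ φ (rightAct (a * g - g * a) D)
        - pureTensor (φ (a * f - a)) (1 - φ f) + pureTensor (1 - φ f) (φ (f * a - a)) := by
    have e1 : rightAct (a * g - g * a) D = rightAct (a * g) D - rightAct (g * a) D := by
      rw [← rightActL_apply, map_sub]; rfl
    have e2 : pureTensor (φ (a * f - a)) (1 - φ f) = - pureTensor (φ a * (1 - φ f)) (1 - φ f) := by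
      have : φ (a * f - a) = - (φ a * (1 - φ f)) := by rw [map_sub, hφ]; noncomm_ring
      rw [this, ← pureTensorL_apply, ← pureTensorL_apply, ← neg_apply, ← map_neg]
    have e3 : pureTensor (1 - φ f) (φ (f * a - a)) = - pureTensor (1 - φ f) ((1 - φ f) * φ a) := by
      have : φ (f * a - a) = - ((1 - φ f) * φ a) := by rw [map_sub, hφ]; noncomm_ring
      rw [this, ← pureTensorL_apply, ← pureTensorL_apply, ← map_neg]
    rw [e1, e2, e3, unitalDiagonal, map_add, map_add, leftAct_map hφ, rightAct_map hφ,
      leftAct_pureTensor, rightAct_pureTensor, rightAct_rightAct, leftAct_rightAct]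
    simp only [map_sub, rightAct_rightAct, ← hg]
    abel
  have h3 : ‖ProjTensorSq.map φ φ (rightAct g (leftAct a D - rightAct a D))‖
      ≤ ‖rightAct g (leftAct a D - rightAct a D)‖ := ProjTensorSq.norm_map_le φ φ hle hle _
  have h4 : ‖ProjTensorSq.map φ φ (rightAct (a * g - g * a) D)‖
      ≤ (1 + C) * (‖a * f - a‖ + ‖f * a - a‖) * C := by
    refine (ProjTensorSq.norm_map_le φ φ hle hle _).trans ((norm_rightAct_le _ _).trans ?_)
    gcongr
    exact norm_mul_sub_mul_unitCorrection_le hf a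
  have h5 : ‖pureTensor (φ (a * f - a)) (1 - φ f)‖ ≤ ‖a * f - a‖ * (‖(1 : U)‖ + C) :=
    (norm_pureTensor_le _ _).trans (by gcongr; exact hle _)
  have h6 : ‖pureTensor (1 - φ f) (φ (f * a - a))‖ ≤ (‖(1 : U)‖ + C) * ‖f * a - a‖ :=
    (norm_pureTensor_le _ _).trans (by gcongr; exact hle _)
  rw [h2]
  refine (norm_add_le _ _).trans ((add_le_add ((norm_sub_le _ _).trans
    (add_le_add (norm_add_le _ _) le_rfl)) le_rfl).trans ?_)
  linarith

theorem unitalDiagonal_mem_closedTensorSpan {φ : B →L[ℂ] U} {W : Set U} (hφW : ∀ b, φ b ∈ W)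
    (hφ1 : ∀ b, 1 - φ b ∈ W) (f : B) (D : ProjTensorSq B) :
    unitalDiagonal φ f D ∈ closedTensorSpan W :=
  add_mem (map_mem_closedTensorSpan hφW _) (pureTensor_mem_closedTensorSpan (hφ1 f) (hφ1 f))

/-- A diagonal filter of an algebra mapping to `U` yields a central filter in `U`. -/
theorem IsDiagonalFilter.isCentralFilter [CompleteSpace U] [CompleteSpace B] {φ : B →L[ℂ] U}
    (hφ : ∀ a b, φ (a * b) = φ a * φ b) (hle : ∀ b, ‖φ b‖ ≤ ‖b‖) {l : Filter (ProjTensorSq B)}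
    {C : ℝ} (hl : IsDiagonalFilter B l C) :
    IsCentralFilter (Set.range φ)
      (l.bind fun D₀ => l.map fun D => unitalDiagonal φ (mulMap B D₀) D)
      ((C + C + C * C) * C + (‖(1 : U)‖ + C) * (‖(1 : U)‖ + C)) := by
  have := hl.neBot
  refine ⟨Filter.neBot_bind fun _ => inferInstance, ?_, ?_, ?_⟩
  · rw [Filter.eventually_bind]
    filter_upwards [hl.bounded] with D₀ hD₀
    rw [eventually_map]
    filter_upwards [hl.bounded] with D hD
    exact norm_unitalDiagonal_le hle ((norm_mulMap_le D₀).trans hD₀) hD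
  · refine Filter.tendsto_bind_of_norm_le (r := fun _ => 0) tendsto_const_nhds
      (Eventually.of_forall fun D₀ ε hε => ?_)
    rw [eventually_map]
    have := tendsto_iff_norm_sub_tendsto_zero.1
      (hl.mul_right (mulMap B D₀ + mulMap B D₀ - mulMap B D₀ * mulMap B D₀))
    filter_upwards [this.eventually (gt_mem_nhds hε)] with D hD
    rw [mulMap_unitalDiagonal hφ, zero_add]
    exact (hle _).trans hD.le
  · rintro _ ⟨a, rfl⟩
    refine Filter.tendsto_bind_of_norm_le
      (r := fun D₀ => ((1 + C) * C + (‖(1 : U)‖ + C)) *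
        (‖a * mulMap B D₀ - a‖ + ‖mulMap B D₀ * a - a‖)) ?_ ?_
    · have h1 := tendsto_iff_norm_sub_tendsto_zero.1 (hl.mul_left a)
      have h2 := tendsto_iff_norm_sub_tendsto_zero.1 (hl.mul_right a)
      simpa using (h1.add h2).const_mul ((1 + C) * C + (‖(1 : U)‖ + C))
    · filter_upwards [hl.bounded] with D₀ hD₀ ε hε
      have h1 := (((rightAct (mulMap B D₀ + mulMap B D₀
        - mulMap B D₀ * mulMap B D₀)).continuous.tendsto _).comp (hl.central a)).norm
      rw [map_zero, norm_zero] at h1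
      rw [eventually_map]
      filter_upwards [hl.bounded, h1.eventually (gt_mem_nhds hε)] with D hD hDε
      rw [sub_zero]
      refine (norm_commutator_unitalDiagonal_le hφ hle ((norm_mulMap_le D₀).trans hD₀)
        hD a).trans ?_
      gcongr
      exact hDε.le

/-- Adjoining the image of an amenable algebra to the set commuting with a central filter. -/
theorem IsCentralFilter.exists_union_range [CompleteSpace U] [CompleteSpace B] {φ : B →L[ℂ] U}
    (hφ : ∀ a b, φ (a * b) = φ a * φ b) (hle : ∀ b, ‖φ b‖ ≤ ‖b‖) (hB : IsAmenable B)
    {V : Set U} {l : Filter (ProjTensorSq U)} {C : ℝ} (hl : IsCentralFilter V l C)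
    (hleft : ∀ j ∈ V, ∀ b, j * φ b ∈ V) (hright : ∀ j ∈ V, ∀ b, φ b * j ∈ V) :
    ∃ (l' : Filter (ProjTensorSq U)) (C' : ℝ), IsCentralFilter (V ∪ Set.range φ) l' C' := by
  obtain ⟨lB, CB, -, hlB⟩ := hB.exists_isDiagonalFilter
  -- All legs of the corrected diagonal have one of these two forms, and multiplying an element of V
  -- by either stays in the asymptotic centralizer.
  let W : Set U := Set.range φ ∪ Set.range fun b => 1 - φ b
  refine ⟨_, _, hl.sandwich (hlB.isCentralFilter hφ hle) (W := W) ?_ ?_ ?_⟩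
  · rw [Filter.eventually_bind]
    refine Eventually.of_forall fun D₀ => eventually_map.2 (Eventually.of_forall fun D => ?_)
    exact unitalDiagonal_mem_closedTensorSpan (φ := φ) (W := W) (fun b => Or.inl ⟨b, rfl⟩)
      (fun b => Or.inr ⟨b, rfl⟩) _ D
  · rintro j hj _ (⟨b, rfl⟩ | ⟨b, rfl⟩)
    · exact hl.central (hleft j hj b)
    · simp only [mul_sub, mul_one]
      exact sub_mem (hl.central hj) (hl.central (hleft j hj b))
  · rintro j hj _ (⟨b, rfl⟩ | ⟨b, rfl⟩)
    · exact hl.central (hright j hj b)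
    · simp only [sub_mul, one_mul]
      exact sub_mem (hl.central hj) (hl.central (hright j hj b))

theorem isCentralFilter_empty [CompleteSpace U] :
    IsCentralFilter (∅ : Set U) (pure (pureTensor 1 1)) ‖pureTensor (1 : U) 1‖ where
  neBot := inferInstance
  bounded := eventually_pure.2 le_rfl
  tendsto_mulMap := by
    rw [tendsto_pure_left]
    intro s hs
    simpa using mem_of_mem_nhds hs
  central := Set.empty_subset _

end UnitalDiagonal

/-! ### Bounded approximate identities through complementary elements -/

section AnnihilatingFilters

/-- A bounded filter of elements `r` of augmentation `1` with `r a → 0` and `a r → 0` for `a ∈ V`;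
then `1 - r` is a bounded approximate identity for `V`. -/
structure IsAnnihilatingFilter {U : Type u} [NormedRing U] (ε : U →+* ℂ) (V : Set U)
    (n : Filter U) (C : ℝ) : Prop where
  neBot : n.NeBot
  bounded : ∀ᶠ r in n, ‖r‖ ≤ C
  augmentation : ∀ᶠ r in n, ε r = 1
  mul_left : ∀ a ∈ V, Tendsto (fun r => a * r) n (𝓝 0)
  mul_right : ∀ a ∈ V, Tendsto (fun r => r * a) n (𝓝 0)

variable {U : Type u} [NormedRing U] {ε : U →+* ℂ}
  {B : Type u} [NonUnitalNormedRing B] [NormedSpace ℂ B] [IsScalarTower ℂ B B]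
  [SMulCommClass ℂ B B] [CompleteSpace B]

theorem isAnnihilatingFilter_empty :
    IsAnnihilatingFilter ε ∅ (pure 1) ‖(1 : U)‖ where
  neBot := inferInstance
  bounded := eventually_pure.2 le_rfl
  augmentation := eventually_pure.2 (map_one ε)
  mul_left _ ha := ha.elim
  mul_right _ ha := ha.elim

/-- Replace r by (1 - f) r (1 - f), with f in the approximate identity of the new subalgebra. The
outer factors annihilate that subalgebra as f varies; for j ∈ V, j and jf both lie in V, so r
already annihilates j(1 - f) with f fixed. Hence r runs first. -/
theorem IsAnnihilatingFilter.exists_union_range [NormedSpace ℂ U] {φ : B →L[ℂ] U}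
    (hφ : ∀ a b, φ (a * b) = φ a * φ b) (hle : ∀ b, ‖φ b‖ ≤ ‖b‖) (hε : ∀ b, ε (φ b) = 0)
    (hB : IsAmenable B) {V : Set U} {n : Filter U} {C : ℝ} (hn : IsAnnihilatingFilter ε V n C)
    (hleft : ∀ j ∈ V, ∀ b, j * φ b ∈ V) (hright : ∀ j ∈ V, ∀ b, φ b * j ∈ V) :
    ∃ (n' : Filter U) (C' : ℝ), IsAnnihilatingFilter ε (V ∪ Set.range φ) n' C' := by
  obtain ⟨l, K, hK, hl⟩ := hB.exists_isDiagonalFilter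
  have := hl.neBot
  have := hn.neBot
  have hC : 0 ≤ C := by
    obtain ⟨z, hz⟩ := hn.bounded.exists
    exact (norm_nonneg z).trans hz
  set M := ‖(1 : U)‖ + K
  have hf {D : ProjTensorSq B} (hD : ‖D‖ ≤ K) : ‖1 - φ (mulMap B D)‖ ≤ M :=
    (norm_sub_le _ _).trans
      (add_le_add le_rfl ((hle _).trans ((norm_mulMap_le D).trans hD)))
  refine ⟨l.bind fun D => n.map fun r => (1 - φ (mulMap B D)) * r * (1 - φ (mulMap B D)),
    M * C * M, Filter.neBot_bind fun _ => inferInstance, ?_, ?_, ?_, ?_⟩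
  · rw [Filter.eventually_bind]
    filter_upwards [hl.bounded] with D hD
    rw [eventually_map]
    filter_upwards [hn.bounded] with r hr
    exact norm_mul_le_of_le (norm_mul_le_of_le (hf hD) hr) (hf hD)
  · rw [Filter.eventually_bind]
    refine Eventually.of_forall fun D => ?_
    rw [eventually_map]
    filter_upwards [hn.augmentation] with r hr
    simp [hr, hε]
  · rintro _ (hj | ⟨a, rfl⟩)
    · rename_i j
      refine Filter.tendsto_bind_of_norm_le (r := fun _ => 0) tendsto_const_nhds
        (Eventually.of_forall fun D δ hδ => ?_)
      have h1 := (((hn.mul_left j hj).sub (hn.mul_left _ (hleft j hj (mulMap B D)))).mul_const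
        (1 - φ (mulMap B D))).norm
      rw [sub_zero, zero_mul, norm_zero] at h1
      rw [eventually_map]
      filter_upwards [h1.eventually (gt_mem_nhds hδ)] with r hr
      rw [sub_zero, zero_add, show j * ((1 - φ (mulMap B D)) * r * (1 - φ (mulMap B D)))
        = (j * r - j * φ (mulMap B D) * r) * (1 - φ (mulMap B D)) by noncomm_ring]
      exact hr.le
    · refine Filter.tendsto_bind_of_norm_le (r := fun D => ‖a * mulMap B D - a‖ * C * M) ?_ ?_
      · have := tendsto_iff_norm_sub_tendsto_zero.1 (hl.mul_left a)
        simpa using (this.mul_const C).mul_const M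
      · filter_upwards [hl.bounded] with D hD δ hδ
        rw [eventually_map]
        filter_upwards [hn.bounded] with r hr
        rw [sub_zero, show φ a * ((1 - φ (mulMap B D)) * r * (1 - φ (mulMap B D)))
          = -(φ (a * mulMap B D - a) * r * (1 - φ (mulMap B D))) by
            rw [map_sub, hφ]; noncomm_ring, norm_neg]
        refine (norm_mul_le_of_le (norm_mul_le_of_le (hle _) hr) (hf hD)).trans ?_
        linarith
  · rintro _ (hj | ⟨a, rfl⟩)
    · rename_i j
      refine Filter.tendsto_bind_of_norm_le (r := fun _ => 0) tendsto_const_nhds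
        (Eventually.of_forall fun D δ hδ => ?_)
      have h1 := (((hn.mul_right j hj).sub (hn.mul_right _ (hright j hj (mulMap B D)))).const_mul
        (1 - φ (mulMap B D))).norm
      rw [sub_zero, mul_zero, norm_zero] at h1
      rw [eventually_map]
      filter_upwards [h1.eventually (gt_mem_nhds hδ)] with r hr
      rw [sub_zero, zero_add, show (1 - φ (mulMap B D)) * r * (1 - φ (mulMap B D)) * j
        = (1 - φ (mulMap B D)) * (r * j - r * (φ (mulMap B D) * j)) by noncomm_ring]
      exact hr.le
    · refine Filter.tendsto_bind_of_norm_le (r := fun D => M * C * ‖mulMap B D * a - a‖) ?_ ?_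
      · have := tendsto_iff_norm_sub_tendsto_zero.1 (hl.mul_right a)
        simpa using this.const_mul (M * C)
      · filter_upwards [hl.bounded] with D hD δ hδ
        rw [eventually_map]
        filter_upwards [hn.bounded] with r hr
        rw [sub_zero, show (1 - φ (mulMap B D)) * r * (1 - φ (mulMap B D)) * φ a
          = -((1 - φ (mulMap B D)) * r * φ (mulMap B D * a - a)) by
            rw [map_sub, hφ]; noncomm_ring, norm_neg]
        refine (norm_mul_le_of_le (norm_mul_le_of_le (hf hD) hr) (hle _)).trans ?_
        linarith

end AnnihilatingFilters

/-! ### Returning from the unitization to the algebra -/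

section Unitization

variable (A : Type u) [NonUnitalNormedRing A] [NormedSpace ℂ A]
  [IsScalarTower ℂ A A] [SMulCommClass ℂ A A]

/-- The unitization of `A` with the `ℓ¹`-norm. -/
abbrev L1Unitization : Type u := WithLp 1 (Unitization ℂ A)

/-- The embedding of `A` into its unitization. -/
def unitizationInr : A →L[ℂ] L1Unitization A :=
  LinearMap.mkContinuous
    ((WithLp.linearEquiv 1 ℂ (Unitization ℂ A)).symm.toLinearMap.comp (Unitization.inrHom ℂ ℂ A))
    1 (fun a => ((WithLp.unitization_norm_inr a).trans (one_mul _).symm).le)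

/-- The projection of the unitization onto `A`. -/
def unitizationSnd : L1Unitization A →L[ℂ] A :=
  LinearMap.mkContinuous
    ((Unitization.sndHom ℂ ℂ A).comp (WithLp.linearEquiv 1 ℂ (Unitization ℂ A)).toLinearMap)
    1 (fun x => by
      rw [one_mul, WithLp.unitization_norm_def]
      exact le_add_of_nonneg_left (norm_nonneg _))

/-- The augmentation character of the unitization. -/
def augmentation : L1Unitization A →+* ℂ :=
  (Unitization.fstHom ℂ A).toRingHom.comp (WithLp.unitizationAlgEquiv ℂ).toRingEquiv.toRingHom

variable {A}

theorem norm_unitizationInr (a : A) : ‖unitizationInr A a‖ = ‖a‖ :=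
  WithLp.unitization_norm_inr a

theorem unitizationInr_mul (a b : A) :
    unitizationInr A (a * b) = unitizationInr A a * unitizationInr A b :=
  congrArg (WithLp.toLp 1) (Unitization.inr_mul ℂ a b)

theorem augmentation_inr (a : A) : augmentation A (unitizationInr A a) = 0 := rfl

theorem norm_unitizationSnd_le (x : L1Unitization A) : ‖unitizationSnd A x‖ ≤ ‖x‖ := by
  rw [WithLp.unitization_norm_def]
  exact le_add_of_nonneg_left (norm_nonneg _)

theorem unitizationSnd_inr (a : A) : unitizationSnd A (unitizationInr A a) = a := rfl

theorem unitizationInr_snd {x : L1Unitization A} (hx : augmentation A x = 0) :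
    unitizationInr A (unitizationSnd A x) = x :=
  congrArg (WithLp.toLp 1) (Unitization.ext hx.symm rfl)

theorem map_snd_map_inr (z : ProjTensorSq A) :
    ProjTensorSq.map (unitizationSnd A) (unitizationSnd A)
      (ProjTensorSq.map (unitizationInr A) (unitizationInr A) z) = z :=
  ProjTensorSq.ext_pureTensor
    (F := (ProjTensorSq.map (unitizationSnd A) (unitizationSnd A)).comp
      (ProjTensorSq.map (unitizationInr A) (unitizationInr A)))
    (G := ContinuousLinearMap.id ℂ _) (fun a b => by simp [unitizationSnd_inr]) z

/-- Compression of a tensor over the unitization by an element of `A` to a tensor over `A`. -/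
def compressTensor (u : L1Unitization A) (T : ProjTensorSq (L1Unitization A)) : ProjTensorSq A :=
  ProjTensorSq.map (unitizationSnd A) (unitizationSnd A) (leftAct u (rightAct u T))

/-- The legs ux and yu have augmentation zero, so they lie in `A` and the projection onto `A` loses
nothing. -/
theorem map_inr_compressTensor {u : L1Unitization A} (hu : augmentation A u = 0)
    (T : ProjTensorSq (L1Unitization A)) :
    ProjTensorSq.map (unitizationInr A) (unitizationInr A) (compressTensor u T)
      = leftAct u (rightAct u T) :=
  ProjTensorSq.ext_pureTensor
    (F := (ProjTensorSq.map (unitizationInr A) (unitizationInr A)).comp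
      ((ProjTensorSq.map (unitizationSnd A) (unitizationSnd A)).comp
        ((leftAct u).comp (rightAct u))))
    (G := (leftAct u).comp (rightAct u)) (fun x y => by
      simp only [ContinuousLinearMap.comp_apply, rightAct_pureTensor, leftAct_pureTensor,
        ProjTensorSq.map_pureTensor]
      rw [unitizationInr_snd (by simp [hu]), unitizationInr_snd (by simp [hu])]) T

theorem norm_compressTensor_le (u : L1Unitization A) (T : ProjTensorSq (L1Unitization A)) :
    ‖compressTensor u T‖ ≤ ‖u‖ * (‖u‖ * ‖T‖) :=
  (ProjTensorSq.norm_map_le _ _ norm_unitizationSnd_le norm_unitizationSnd_le _).trans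
    ((norm_leftAct_le _ _).trans (by gcongr; exact norm_rightAct_le _ _))

theorem inr_mulMap_compressTensor [CompleteSpace A] {u : L1Unitization A}
    (hu : augmentation A u = 0) (T : ProjTensorSq (L1Unitization A)) :
    unitizationInr A (mulMap A (compressTensor u T)) = u * (mulMap _ T * u) := by
  rw [← mulMap_map unitizationInr_mul, map_inr_compressTensor hu, mulMap_leftAct, mulMap_rightAct]

/-- The embedding of tensors has a contractive left inverse, so the commutator may be estimated over
the unitization. -/
theorem norm_commutator_compressTensor_le {u : L1Unitization A}
    (hu : augmentation A u = 0) (T : ProjTensorSq (L1Unitization A)) (a : A) :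
    ‖leftAct a (compressTensor u T) - rightAct a (compressTensor u T)‖
      ≤ ‖leftAct (unitizationInr A a) (leftAct u (rightAct u T))
        - rightAct (unitizationInr A a) (leftAct u (rightAct u T))‖ := by
  rw [← map_inr_compressTensor hu, leftAct_map unitizationInr_mul,
    rightAct_map unitizationInr_mul, ← map_sub]
  conv_lhs => rw [← map_snd_map_inr (leftAct a (compressTensor u T) - _)]
  exact ProjTensorSq.norm_map_le _ _ norm_unitizationSnd_le norm_unitizationSnd_le _

/-- Moving au and ua across T turns the commutator of a with u · T · u into T · (auu) - (uua) · T,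
which is close to T · a - a · T when u is an approximate unit for a. -/
theorem norm_commutator_leftAct_rightAct_le {U : Type u} [NormedRing U] [NormedAlgebra ℂ U]
    (a u : U) (T : ProjTensorSq U) :
    ‖leftAct a (leftAct u (rightAct u T)) - rightAct a (leftAct u (rightAct u T))‖
      ≤ (‖a * u * u - a‖ + ‖u * (u * a) - a‖) * ‖T‖
        + (‖u‖ * ‖leftAct (a * u) T - rightAct (a * u) T‖
          + ‖u‖ * ‖leftAct (u * a) T - rightAct (u * a) T‖
          + ‖leftAct a T - rightAct a T‖) := by
  have h : leftAct a (leftAct u (rightAct u T)) - rightAct a (leftAct u (rightAct u T))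
      = (rightAct (a * u * u - a) T - leftAct (u * (u * a) - a) T)
        + (rightAct u (leftAct (a * u) T - rightAct (a * u) T)
          + leftAct u (leftAct (u * a) T - rightAct (u * a) T)
          - (leftAct a T - rightAct a T)) := by
    have e1 : rightAct (a * u * u - a) T = rightAct (a * u * u) T - rightAct a T := by
      rw [← rightActL_apply, map_sub]; rfl
    have e2 : leftAct (u * (u * a) - a) T = leftAct (u * (u * a)) T - leftAct a T := by
      rw [← leftActL_apply, map_sub]; rfl
    rw [e1, e2]
    simp only [map_sub, leftAct_leftAct, rightAct_rightAct, leftAct_rightAct]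
    abel
  rw [h]
  refine (norm_add_le _ _).trans (add_le_add ?_ ?_)
  · refine (norm_sub_le _ _).trans ?_
    rw [add_mul]
    exact add_le_add (norm_rightAct_le _ _) (norm_leftAct_le _ _)
  · exact (norm_sub_le _ _).trans (add_le_add ((norm_add_le _ _).trans
      (add_le_add (norm_rightAct_le _ _) (norm_leftAct_le _ _))) le_rfl)

variable [CompleteSpace A]

/-- Compressing a central filter of the unitization by a bounded approximate identity of `A` gives
a diagonal filter of `A`. -/
theorem IsCentralFilter.isDiagonalFilter {l : Filter (ProjTensorSq (L1Unitization A))} {C : ℝ}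
    (hl : IsCentralFilter (Set.range (unitizationInr A)) l C) {n : Filter (L1Unitization A)} {K : ℝ}
    (hn : IsAnnihilatingFilter (augmentation A) (Set.range (unitizationInr A)) n K) :
    IsDiagonalFilter A (n.bind fun r => l.map (compressTensor (1 - r)))
      ((‖(1 : L1Unitization A)‖ + K) * ((‖(1 : L1Unitization A)‖ + K) * C)) := by
  have := hl.neBot
  have := hn.neBot
  set M := ‖(1 : L1Unitization A)‖ + K
  have hu {r : L1Unitization A} (hr : ‖r‖ ≤ K) : ‖1 - r‖ ≤ M :=
    (norm_sub_le _ _).trans (add_le_add le_rfl hr)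
  have hε {r : L1Unitization A} (hr : augmentation A r = 1) : augmentation A (1 - r) = 0 := by
    rw [map_sub, map_one, hr, sub_self]
  have hsqr {r : L1Unitization A} (hr : ‖r‖ ≤ K) (x : L1Unitization A) :
      ‖x * (1 - r) * (1 - r) - x‖ ≤ ‖x * r‖ * (1 + M) := by
    rw [show x * (1 - r) * (1 - r) - x = -(x * r + x * r * (1 - r)) by noncomm_ring, norm_neg,
      mul_add, mul_one]
    exact (norm_add_le _ _).trans (add_le_add le_rfl (norm_mul_le_of_le le_rfl (hu hr)))
  have hsql {r : L1Unitization A} (hr : ‖r‖ ≤ K) (x : L1Unitization A) :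
      ‖(1 - r) * ((1 - r) * x) - x‖ ≤ (1 + M) * ‖r * x‖ := by
    rw [show (1 - r) * ((1 - r) * x) - x = -(r * x + (1 - r) * (r * x)) by noncomm_ring, norm_neg,
      add_mul, one_mul]
    exact (norm_add_le _ _).trans (add_le_add le_rfl (norm_mul_le_of_le (hu hr) le_rfl))
  refine ⟨Filter.neBot_bind fun _ => inferInstance, ?_, fun a => ?_, fun a => ?_, fun a => ?_⟩
  · rw [Filter.eventually_bind]
    filter_upwards [hn.bounded] with r hr
    rw [eventually_map]
    filter_upwards [hl.bounded] with T hT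
    have hM0 := (norm_nonneg _).trans (hu hr)
    exact (norm_compressTensor_le _ _).trans
      (mul_le_mul (hu hr) (mul_le_mul (hu hr) hT (norm_nonneg _) hM0) (by positivity) hM0)
  · refine Filter.tendsto_bind_of_norm_le
      (r := fun r => ‖unitizationInr A a * r‖ * (1 + M)) ?_ ?_
    · simpa using (hn.mul_left _ ⟨a, rfl⟩).norm.mul_const (1 + M)
    · filter_upwards [hn.bounded, hn.augmentation] with r hr hr1 δ hδ
      have h1 := (((hl.tendsto_mulMap.sub_const 1).const_mul
        (unitizationInr A a * (1 - r))).mul_const (1 - r)).norm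
      rw [sub_self, mul_zero, zero_mul, norm_zero] at h1
      rw [eventually_map]
      filter_upwards [h1.eventually (gt_mem_nhds hδ)] with T hT
      rw [← norm_unitizationInr, map_sub, unitizationInr_mul, inr_mulMap_compressTensor (hε hr1),
        show unitizationInr A a * ((1 - r) * (mulMap _ T * (1 - r))) - unitizationInr A a
          = (unitizationInr A a * (1 - r) * (1 - r) - unitizationInr A a)
            + unitizationInr A a * (1 - r) * (mulMap _ T - 1) * (1 - r) by noncomm_ring]
      exact (norm_add_le _ _).trans (add_le_add (hsqr hr _) hT.le)
  · refine Filter.tendsto_bind_of_norm_le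
      (r := fun r => (1 + M) * ‖r * unitizationInr A a‖) ?_ ?_
    · simpa using (hn.mul_right _ ⟨a, rfl⟩).norm.const_mul (1 + M)
    · filter_upwards [hn.bounded, hn.augmentation] with r hr hr1 δ hδ
      have h1 := (((hl.tendsto_mulMap.sub_const 1).const_mul
        (1 - r)).mul_const ((1 - r) * unitizationInr A a)).norm
      rw [sub_self, mul_zero, zero_mul, norm_zero] at h1
      rw [eventually_map]
      filter_upwards [h1.eventually (gt_mem_nhds hδ)] with T hT
      rw [← norm_unitizationInr, map_sub, unitizationInr_mul, inr_mulMap_compressTensor (hε hr1),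
        show (1 - r) * (mulMap _ T * (1 - r)) * unitizationInr A a - unitizationInr A a
          = ((1 - r) * ((1 - r) * unitizationInr A a) - unitizationInr A a)
            + (1 - r) * (mulMap _ T - 1) * ((1 - r) * unitizationInr A a) by noncomm_ring]
      exact (norm_add_le _ _).trans (add_le_add (hsql hr _) hT.le)
  · refine Filter.tendsto_bind_of_norm_le (r := fun r => (‖unitizationInr A a * r‖ * (1 + M)
      + (1 + M) * ‖r * unitizationInr A a‖) * C) ?_ ?_
    · simpa using (((hn.mul_left _ ⟨a, rfl⟩).norm.mul_const (1 + M)).add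
        ((hn.mul_right _ ⟨a, rfl⟩).norm.const_mul (1 + M))).mul_const C
    · filter_upwards [hn.bounded, hn.augmentation] with r hr hr1 δ hδ
      -- Applied to a(1 - r), (1 - r)a and a, all of which lie in the ideal `A`; r itself does not.
      have hcentral (x : L1Unitization A) (hx : augmentation A x = 0) :
          Tendsto (fun T => ‖leftAct x T - rightAct x T‖) l (𝓝 0) := by
        rw [← unitizationInr_snd hx, ← norm_zero (E := ProjTensorSq (L1Unitization A))]
        exact (mem_asymptoticCentralizer.1 (hl.central ⟨_, rfl⟩)).norm
      have h1 := (((hcentral (unitizationInr A a * (1 - r)) (by simp [augmentation_inr])).const_mul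
        ‖1 - r‖).add ((hcentral ((1 - r) * unitizationInr A a)
          (by simp [augmentation_inr])).const_mul ‖1 - r‖)).add
        (hcentral _ (augmentation_inr a))
      rw [mul_zero, add_zero, add_zero] at h1
      rw [eventually_map]
      filter_upwards [hl.bounded, h1.eventually (gt_mem_nhds hδ)] with T hTC hT
      rw [sub_zero]
      refine (norm_commutator_compressTensor_le (hε hr1) T a).trans
        ((norm_commutator_leftAct_rightAct_le _ _ T).trans (add_le_add ?_ hT.le))
      exact mul_le_mul (add_le_add (hsqr hr _) (hsql hr _)) hTC (norm_nonneg _)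
        ((add_nonneg (norm_nonneg _) (norm_nonneg _)).trans
          (add_le_add (hsqr hr (unitizationInr A a)) (hsql hr (unitizationInr A a))))

end Unitization

/-! ### Induction over the ideals of the semilattice -/

section GradedAmenability

variable {S : Type v} [CommSemigroup S] [Fintype S]
  {A : Type u} [NonUnitalNormedRing A] [NormedSpace ℂ A]
  [IsScalarTower ℂ A A] [SMulCommClass ℂ A A] [CompleteSpace A] {𝔄 : S → Submodule ℂ A}

variable (𝔄) in
/-- The homogeneous elements with degree in `I`, embedded into the unitization of `A`. -/
def homogeneousSet (I : Finset S) : Set (L1Unitization A) :=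
  {x | ∃ s ∈ I, ∃ a ∈ 𝔄 s, unitizationInr A a = x}

/-- A nonempty ideal of a finite semilattice becomes a smaller ideal when a maximal element is
removed. -/
theorem exists_isIdeal_erase [DecidableEq S] (hS : ∀ s : S, s * s = s) {I : Finset S}
    (hI : ∀ s ∈ I, ∀ t, s * t ∈ I) (hne : I.Nonempty) :
    ∃ t ∈ I, ∀ s ∈ I.erase t, ∀ r, s * r ∈ I.erase t := by
  -- An element with the most lower bounds is maximal in I, and a product sr with s ≠ t cannot then
  -- equal t.
  obtain ⟨t, ht, hmax⟩ := I.exists_max_image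
    (fun s => (Finset.univ.filter fun q => q * s = q).card) hne
  refine ⟨t, ht, fun s hs r => Finset.mem_erase.2 ⟨fun hsr => ?_, ?_⟩⟩
  · obtain ⟨hst, hsI⟩ := Finset.mem_erase.1 hs
    have hts : t * s = t := by rw [← hsr, mul_right_comm, hS]
    have hsub : (Finset.univ.filter fun q => q * t = q) ⊆ Finset.univ.filter fun q => q * s = q := by
      intro q hq
      simp only [Finset.mem_filter, Finset.mem_univ, true_and] at hq ⊢
      rw [← hq, mul_assoc, hts]
    have heq := Finset.eq_of_subset_of_card_le hsub (hmax s hsI)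
    have hmem : s ∈ Finset.univ.filter fun q => q * t = q := by
      rw [heq]
      simp [hS]
    refine hst ?_
    rw [← (Finset.mem_filter.1 hmem).2, mul_comm, hts]
  · exact hI s (Finset.mem_of_mem_erase hs) r

/-- Induction on the size of I, peeling off a maximal t. What remains is an ideal of S, so products
of its homogeneous elements with the component of t stay homogeneous with degree in that ideal; this
is what both extension steps require. -/
theorem IsGradedBy.exists_filters (h : IsGradedBy 𝔄) (hS : ∀ s : S, s * s = s)
    (ham : ∀ s, IsAmenable (h.component hS s)) (I : Finset S)
    (hI : ∀ s ∈ I, ∀ t, s * t ∈ I) :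
    (∃ l C, IsCentralFilter (homogeneousSet 𝔄 I) l C) ∧
      ∃ n C, IsAnnihilatingFilter (augmentation A) (homogeneousSet 𝔄 I) n C := by
  classical
  induction hc : I.card generalizing I with
  | zero =>
    have : homogeneousSet 𝔄 I = ∅ := by
      rw [Finset.card_eq_zero] at hc
      simp [homogeneousSet, hc]
    rw [this]
    exact ⟨⟨_, _, isCentralFilter_empty⟩, _, _, isAnnihilatingFilter_empty⟩
  | succ m ih =>
    obtain ⟨t, ht, hI'⟩ := exists_isIdeal_erase hS hI (Finset.card_pos.1 (by omega))
    obtain ⟨⟨l, C, hl⟩, n, K, hn⟩ := ih (I.erase t) hI' (by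
      rw [Finset.card_erase_of_mem ht]; omega)
    let φ : h.component hS t →L[ℂ] L1Unitization A := (unitizationInr A).comp (𝔄 t).subtypeL
    have hφ (a b : h.component hS t) : φ (a * b) = φ a * φ b := unitizationInr_mul (a : A) (b : A)
    have hle (b : h.component hS t) : ‖φ b‖ ≤ ‖b‖ := (norm_unitizationInr (b : A)).le
    have hunion : homogeneousSet 𝔄 I = homogeneousSet 𝔄 (I.erase t) ∪ Set.range φ := by
      ext x
      constructor
      · rintro ⟨s, hs, a, ha, rfl⟩
        by_cases hst : s = t
        · subst hst
          exact Or.inr ⟨⟨a, ha⟩, rfl⟩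
        · exact Or.inl ⟨s, Finset.mem_erase.2 ⟨hst, hs⟩, a, ha, rfl⟩
      · rintro (⟨s, hs, a, ha, rfl⟩ | ⟨a, rfl⟩)
        · exact ⟨s, Finset.mem_of_mem_erase hs, a, ha, rfl⟩
        · exact ⟨t, ht, a, a.2, rfl⟩
    have hleft : ∀ j ∈ homogeneousSet 𝔄 (I.erase t), ∀ b,
        j * φ b ∈ homogeneousSet 𝔄 (I.erase t) := by
      rintro _ ⟨s, hs, a, ha, rfl⟩ b
      exact ⟨s * t, hI' s hs t, a * b, h.mul_mem ha b.2, unitizationInr_mul _ _⟩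
    have hright : ∀ j ∈ homogeneousSet 𝔄 (I.erase t), ∀ b,
        φ b * j ∈ homogeneousSet 𝔄 (I.erase t) := by
      rintro _ ⟨s, hs, a, ha, rfl⟩ b
      refine ⟨t * s, ?_, b * a, h.mul_mem b.2 ha, unitizationInr_mul _ _⟩
      rw [mul_comm]
      exact hI' s hs t
    rw [hunion]
    exact ⟨hl.exists_union_range hφ hle (ham t) hleft hright,
      hn.exists_union_range hφ hle (fun b => augmentation_inr (b : A)) (ham t) hleft hright⟩

theorem IsGradedBy.isAmenable (h : IsGradedBy 𝔄) (hS : ∀ s : S, s * s = s)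
    (ham : ∀ s, IsAmenable (h.component hS s)) : IsAmenable A := by
  obtain ⟨⟨l, C, hl⟩, n, K, hn⟩ := h.exists_filters hS ham Finset.univ (by simp)
  have hmem (a : A) (s : S) :
      unitizationInr A (h.proj s a : A) ∈ homogeneousSet 𝔄 Finset.univ :=
    ⟨s, Finset.mem_univ s, _, (h.proj s a).2, rfl⟩
  have hl' : IsCentralFilter (Set.range (unitizationInr A)) l C :=
    ⟨hl.neBot, hl.bounded, hl.tendsto_mulMap, by
      rintro _ ⟨a, rfl⟩
      rw [← h.sum_proj a, map_sum]
      exact sum_mem fun s _ => hl.central (hmem a s)⟩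
  have hn' : IsAnnihilatingFilter (augmentation A) (Set.range (unitizationInr A)) n K :=
    ⟨hn.neBot, hn.bounded, hn.augmentation, by
      rintro _ ⟨a, rfl⟩
      rw [← h.sum_proj a]
      simp only [map_sum, Finset.sum_mul]
      simpa using tendsto_finsetSum Finset.univ fun s _ => hn.mul_left _ (hmem a s), by
      rintro _ ⟨a, rfl⟩
      rw [← h.sum_proj a]
      simp only [map_sum, Finset.mul_sum]
      simpa using tendsto_finsetSum Finset.univ fun s _ => hn.mul_right _ (hmem a s)⟩
  exact (hl'.isDiagonalFilter hn').isAmenable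

end GradedAmenability

end

theorem theorem2p2 {S : Type v} [CommSemigroup S] [Fintype S] (hS : ∀ s : S, s * s = s)
    {A : Type u} [NonUnitalNormedRing A] [NormedSpace ℂ A] [IsScalarTower ℂ A A]
    [SMulCommClass ℂ A A] [CompleteSpace A]
    (𝔄 : S → Submodule ℂ A) (hgr : IsGradedBy 𝔄) (hne : ∀ s, 𝔄 s ≠ ⊥)
    (ham : ∀ s, IsAmenable (hgr.component hS s))
    (hlink : LinkedApproxIdentities 𝔄 ∨ hgr.LinkedCharacters) :
    IsAmenable A ∧ amenabilityConstant (EllOne S) ≤ amenabilityConstant A :=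
  ⟨hgr.isAmenable hS ham, amenabilityConstant_ellOne_le hgr fun _ hK =>
    hlink.elim (fun hu => hu.exists_isLinkedFunctional hS hgr hne hK)
      (fun hχ => hχ.exists_isLinkedFunctional hK)⟩
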